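/- Let $\mathrm k$ be a field of characteristic $0$, $\mathrm k^{alg}$ an algebraic closure of $\mathrm k$, and $\mathbb F\supseteq \mathrm k^{alg}$ an algebraically closed field. Let $\mathbb X$ be a smooth, geometrically connected, quasi-projective $\mathrm k$-scheme. **Covers.** Let $\{\mathbb Y_\mu\to\mathbb X\}_{\mu\in\mathcal M}$ be a family of finite étale Galois covers with $\mathbb Y_\mu$ connected, which represents all such covers of $\mathbb X$ up to isomorphism over $\mathbb X$. For each $\mu$ fix a generator $a_\mu$ over $\mathrm k$ of the field $\mathrm k^\mu$ of constants (the algebraic closure of $\mathrm k$ in the ring of global functions of $\mathbb Y_\mu$), let $\mathbf f_\mu\in\mathrm k[T]$ be its minimal polynomial, and fix a $\mathrm k$-morphism $\mathbb Y_\mu\to\mathbf P^N_{\mathrm k}$ ($N$ independent of $\mu$) such that the induced morphism $\mathbb Y_\mu\to\mathbf P^N_{\mathrm k^\mu}$ is an immersion. For a zero $\alpha\in\mathrm k^{alg}$ of $\mathbf f_\mu$ let $\mathbb X_{\mu,\alpha}$ be the $\mathrm k^{alg}$-variety obtained from the $\mathrm k^\mu$-scheme $\mathbb Y_\mu$ by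 base change along $a_\mu\mapsto\alpha$, and let $\mu_\alpha:\mathbb X_{\mu,\alpha}\to\mathbb X$ be the covering map; thus $\mathbb X_{\mu,\alpha}(\mathbb F)\subseteq\mathbf P^N(\mathbb F)$. **Distinguished morphisms.** An intermediate morphism $\mathbb X_{\mu,\alpha}\to\mathbb X_{\nu,\beta}$ is a morphism $f$ of $\mathrm k^{alg}$-varieties with $\nu_\beta\circ f=\mu_\alpha$. Fix a projective system of distinguished morphisms: for all $(\mu,\alpha),(\nu,\beta)$ between which an intermediate morphism exists, one chosen intermediate morphism $(\nu_\beta^{-1}\mu_\alpha):\mathbb X_{\mu,\alpha}\to\mathbb X_{\nu,\beta}$, such that $(\mu_\alpha^{-1}\mu_\alpha)$ is the identity and composites of distinguished morphisms are distinguished. Let $G^\sharp$ be the group of all $\sigma\in\mathrm{Gal}(\mathrm k^{alg}/\mathrm k)$ such that $(\nu_\beta^{-1}\mu_\alpha)^\sigma=(\nu_{\sigma(\beta)}^{-1}\mu_{\sigma(\alpha)})$ for all distinguished $(\nu_\beta^{-1}\mu_\alpha)$, and let $\mathrm k^\sharp\subseteq\mathrm k^{alg}$ be the field of all elements fixed by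 $G^\sharp$. **The structure.** Let $\tilde{\mathbb X}^{et}(\mathbb F)=\varprojlim\mathbb X_{\mu,\alpha}(\mathbb F)$ be the projective limit along the distinguished morphisms, with projections $\mathbf p_{\mu,\alpha}:\tilde{\mathbb X}^{et}(\mathbb F)\to\mathbb X_{\mu,\alpha}(\mathbb F)\subseteq\mathbf P^N(\mathbb F)$. Let $\tilde{\mathbf X}^{et}_\sharp(\mathbb F)$ be the two-sorted structure with sorts $\tilde{\mathbb X}^{et}(\mathbb F)$ and $\mathbb F$, the ring operations on $\mathbb F$, names for the elements of $\mathrm k$, and the maps $\mathbf p_\mu:\tilde{\mathbb X}^{et}(\mathbb F)\times\mathrm{Zeros}\,\mathbf f_\mu\to\mathbf P^N(\mathbb F)$, $(u,\alpha)\mapsto\mathbf p_{\mu,\alpha}(u)$, for $\mu\in\mathcal M$. **Proposition.** Restriction of automorphisms to the sort $\mathbb F$ is an isomorphism of groups $$\mathrm{Aut}\,\tilde{\mathbf X}^{et}_\sharp(\mathbb F)\;\cong\;\mathrm{Aut}(\mathbb F/\mathrm k^\sharp).$$ In particular, for $\mathbb F=\mathrm k^{alg}$, restriction is an isomorphism $$\mathrm{Aut}\,\tilde{\mathbf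 X}^{et}_\sharp(\mathrm k^{alg})\;\cong\;\mathrm{Gal}_{\mathrm k^\sharp}=\mathrm{Gal}(\mathrm k^{alg}/\mathrm k^\sharp).$$ -/

import Mathlib

open CategoryTheory CategoryTheory.Limits AlgebraicGeometry

universe u v

noncomputable section

namespace EtaleCoverStructure

/-! ### Projective space and homogeneous coordinates of field-valued points -/

section ProjectiveSpace

/-- The grading of `k[x₀, …, x_N]` by degree. -/
abbrev grading (k : Type u) [Field k] (N : ℕ) : ℕ → Submodule k (MvPolynomial (Fin (N + 1)) k) :=
  MvPolynomial.homogeneousSubmodule (Fin (N + 1)) k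

instance gradingRing (k : Type u) [Field k] (N : ℕ) : GradedRing (grading k N) :=
  MvPolynomial.gradedAlgebra

/-- The projective space `P^N` over `k`, as a scheme. -/
abbrev projSpace (k : Type u) [Field k] (N : ℕ) : Scheme.{u} := Proj (grading k N)

/-- The structure morphism `P^N → Spec k`. -/
def projSpaceToSpec (k : Type u) [Field k] (N : ℕ) : projSpace k N ⟶ Spec (.of k) :=
  Proj.toSpecZero (grading k N) ≫
    Spec.map (CommRingCat.ofHom (algebraMap k (grading k N 0)))

variable {k : Type u} [Field k] {N : ℕ}

lemma X_mem_grading (i : Fin (N + 1)) :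
    (MvPolynomial.X i : MvPolynomial (Fin (N + 1)) k) ∈ grading k N 1 :=
  MvPolynomial.isHomogeneous_X k i

/-- The charts `x_i ≠ 0` cover projective space. -/
lemma exists_chart (p : projSpace k N) :
    ∃ i : Fin (N + 1), p ∈ Proj.basicOpen (grading k N) (MvPolynomial.X i) := by
  have h := Proj.iSup_basicOpen_eq_top' (grading k N)
    (fun i : Fin (N + 1) => (MvPolynomial.X i : MvPolynomial (Fin (N + 1)) k))
    (fun i => ⟨1, X_mem_grading i⟩) (by
      rw [eq_top_iff]
      rintro f -
      induction f using MvPolynomial.induction_on with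
      | C a =>
        exact Subalgebra.algebraMap_mem
          (Algebra.adjoin (grading k N 0) _) (algebraMap k (grading k N 0) a)
      | add p q hp hq => exact add_mem hp hq
      | mul_X p i hp => exact mul_mem hp (Algebra.subset_adjoin ⟨i, rfl⟩))
  exact TopologicalSpace.Opens.mem_iSup.mp (h.ge (TopologicalSpace.Opens.mem_top p))

variable {F : Type u} [Field F]

/-- A chart `x_i ≠ 0` which contains the given `F`-point of projective space. -/
def chart (y : Spec (.of F) ⟶ projSpace k N) : Fin (N + 1) :=
  (exists_chart (y (IsLocalRing.closedPoint F))).choose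

lemma range_subset_chart (y : Spec (.of F) ⟶ projSpace k N) :
    Set.range y ⊆ Set.range
      (Proj.awayι (grading k N) (MvPolynomial.X (chart y)) (X_mem_grading _) one_pos) := by
  rintro _ ⟨z, rfl⟩
  obtain rfl : z = IsLocalRing.closedPoint F := Subsingleton.elim _ _
  have h := (exists_chart (y (IsLocalRing.closedPoint F))).choose_spec
  rw [← Proj.opensRange_awayι (grading k N) _ (X_mem_grading _) one_pos] at h
  exact h

/-- An `F`-point of projective space lying in the chart `Spec k[x₀/x_i, …, x_N/x_i]`, seen as a
ring homomorphism from the coordinate ring of that chart to `F`. -/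
def chartHom (y : Spec (.of F) ⟶ projSpace k N) :
    HomogeneousLocalization.Away (grading k N) (MvPolynomial.X (chart y)) →+* F :=
  (Spec.preimage (IsOpenImmersion.lift
    (Proj.awayι (grading k N) (MvPolynomial.X (chart y)) (X_mem_grading _) one_pos) y
    (range_subset_chart y))).hom

/-- The values of `x_j / x_i` at the given point, where `x_i ≠ 0` is the chosen chart. -/
def coordVector (y : Spec (.of F) ⟶ projSpace k N) : Fin (N + 1) → F := fun j =>
  chartHom y (HomogeneousLocalization.Away.mk (grading k N) (X_mem_grading (chart y)) 1
    (MvPolynomial.X j) (by simpa using X_mem_grading j))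

lemma coordVector_ne_zero (y : Spec (.of F) ⟶ projSpace k N) : coordVector y ≠ 0 := by
  intro h
  have h1 : coordVector y (chart y) = 1 := by
    have : HomogeneousLocalization.Away.mk (grading k N) (X_mem_grading (chart y)) 1
        (MvPolynomial.X (chart y)) (by simpa using X_mem_grading (chart y)) = 1 := by
      apply HomogeneousLocalization.val_injective
      rw [HomogeneousLocalization.Away.val_mk, HomogeneousLocalization.val_one]
      simp
    unfold coordVector
    rw [this, map_one]
  rw [h] at h1
  exact zero_ne_one h1

/-- The point `[c₀ : … : c_N]` of `P^N(F)` given by an `F`-point of the scheme `P^N`. -/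
def homogeneousCoords (y : Spec (.of F) ⟶ projSpace k N) :
    Projectivization F (Fin (N + 1) → F) :=
  Projectivization.mk F (coordVector y) (coordVector_ne_zero y)

variable [Algebra k F]

/-- A field automorphism, applied to all the entries of a vector. -/
def coordMap (N : ℕ) (σ : F ≃ₐ[k] F) :
    (Fin (N + 1) → F) →ₛₗ[(σ : F →+* F)] (Fin (N + 1) → F) where
  toFun c j := σ (c j)
  map_add' _ _ := by ext; simp
  map_smul' _ _ := by ext; simp

lemma coordMap_injective (N : ℕ) (σ : F ≃ₐ[k] F) : Function.Injective (coordMap N σ) :=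
  fun _ _ h => funext fun j => σ.injective (congrFun h j)

/-- The coordinatewise action of the automorphisms of `F` on `P^N(F)`. -/
def projAct (N : ℕ) (σ : F ≃ₐ[k] F) :
    Projectivization F (Fin (N + 1) → F) → Projectivization F (Fin (N + 1) → F) :=
  Projectivization.map (coordMap N σ) (coordMap_injective N σ)

lemma projAct_one (x : Projectivization F (Fin (N + 1) → F)) :
    projAct N (1 : F ≃ₐ[k] F) x = x := by
  induction x using Projectivization.ind with
  | h v hv => rfl

lemma projAct_mul (σ τ : F ≃ₐ[k] F) (x : Projectivization F (Fin (N + 1) → F)) :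
    projAct N (σ * τ) x = projAct N σ (projAct N τ x) := by
  induction x using Projectivization.ind with
  | h v hv => rfl

/-- `X` is quasi-projective over `k`: it is a locally closed subscheme of some `P^n` over `k`. -/
def IsQuasiProjective {X : Scheme.{u}} (s : X ⟶ Spec (.of k)) : Prop :=
  ∃ (n : ℕ) (j : X ⟶ projSpace k n), IsImmersion j ∧ j ≫ projSpaceToSpec k n = s

end ProjectiveSpace

/-! ### Finite étale Galois covers -/

section Covers

variable {k : Type u} [Field k]

/-- `π : Y → X` is a finite étale Galois cover: it is finite étale, `Y` is connected, and
the automorphisms of `Y` over `X` act transitively on all geometric fibres. -/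
structure IsGaloisCover {Y X : Scheme.{u}} (π : Y ⟶ X) : Prop where
  isFinite : IsFinite π
  etale : Etale π
  connected : ConnectedSpace Y
  transitive : ∀ (Ω : Type u) [Field Ω] [IsAlgClosed Ω] (y y' : Spec (.of Ω) ⟶ Y),
    y ≫ π = y' ≫ π → ∃ g : Y ≅ Y, g.hom ≫ π = π ∧ y ≫ g.hom = y'

/-- The homomorphism from `k` to the ring of global functions of a `k`-scheme. -/
def constMap {Y : Scheme.{u}} (t : Y ⟶ Spec (.of k)) : k →+* Γ(Y, ⊤) :=
  ((Scheme.ΓSpecIso (.of k)).inv ≫ t.appTop).hom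

/-- For a global function `a` with `f(a) = 0`, the morphism `Y → Spec k[T]/(f)` with `T ↦ a`. -/
def toConstants {Y : Scheme.{u}} (t : Y ⟶ Spec (.of k)) (f : Polynomial k) (a : Γ(Y, ⊤))
    (h : f.eval₂ (constMap t) a = 0) : Y ⟶ Spec (.of (AdjoinRoot f)) :=
  Y.toSpecΓ ≫ Spec.map (CommRingCat.ofHom (AdjoinRoot.lift (constMap t) a h))

lemma toConstants_comp {Y : Scheme.{u}} (t : Y ⟶ Spec (.of k)) (f : Polynomial k) (a : Γ(Y, ⊤))
    (h : f.eval₂ (constMap t) a = 0) :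
    toConstants t f a h ≫ Spec.map (CommRingCat.ofHom (AdjoinRoot.of f)) = t := by
  have : CommRingCat.ofHom (AdjoinRoot.of f) ≫
      CommRingCat.ofHom (AdjoinRoot.lift (constMap t) a h) =
        (Scheme.ΓSpecIso (.of k)).inv ≫ t.appTop := by
    ext x
    simp [constMap]
  rw [toConstants, Category.assoc, ← Spec.map_comp, this, Spec.map_comp,
    ← Scheme.toSpecΓ_naturality_assoc]
  simp

/-- A presentation of a finite étale Galois cover of the `k`-scheme `X`.  The generator `a` of the
field of constants `k^Y` (the algebraic closure of `k` in the ring of global functions of `Y`) has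
minimal polynomial `f` over `k`; this identifies `k^Y` with `k[T]/(f)`.  The cover comes with an
embedding, as a `k^Y`-scheme, into the projective space `P^N` over `k^Y`. -/
structure CoverPresentation {X : Scheme.{u}} (s : X ⟶ Spec (.of k)) (N : ℕ) where
  Y : Scheme.{u}
  π : Y ⟶ X
  isGaloisCover : IsGaloisCover π
  f : Polynomial k
  monic : f.Monic
  irreducible : Irreducible f
  a : Γ(Y, ⊤)
  eval_a : f.eval₂ (constMap (π ≫ s)) a = 0
  /-- every constant is a polynomial in `a` over `k` -/
  generates : ∀ b : Γ(Y, ⊤), (constMap (π ≫ s)).IsIntegralElem b →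
    ∃ g : Polynomial k, g.eval₂ (constMap (π ≫ s)) a = b
  emb : Y ⟶ projSpace k N
  emb_over : emb ≫ projSpaceToSpec k N = π ≫ s
  isImmersion_emb : IsImmersion (pullback.lift emb (toConstants (π ≫ s) f a eval_a)
    (emb_over.trans (toConstants_comp (π ≫ s) f a eval_a).symm) :
      Y ⟶ pullback (projSpaceToSpec k N) (Spec.map (CommRingCat.ofHom (AdjoinRoot.of f))))

variable {X : Scheme.{u}} {s : X ⟶ Spec (.of k)} {N : ℕ}

/-- The presented covers represent all finite étale Galois covers of `X`, up to isomorphism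
over `X`. -/
def RepresentsAllCovers {M : Type v} (C : M → CoverPresentation s N) : Prop :=
  ∀ (Y : Scheme.{u}) (π : Y ⟶ X), IsGaloisCover π →
    ∃ (μ : M) (e : Y ≅ (C μ).Y), e.hom ≫ (C μ).π = π

namespace CoverPresentation

variable (c : CoverPresentation s N)

/-- The morphism `Y → Spec k^Y`. -/
def toConst : c.Y ⟶ Spec (.of (AdjoinRoot c.f)) :=
  toConstants (c.π ≫ s) c.f c.a c.eval_a

variable {K : Type u} [Field K] [Algebra k K]

lemma eval_root (α : c.f.rootSet K) : c.f.eval₂ (algebraMap k K) (α : K) = 0 :=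
  Polynomial.aeval_eq_zero_of_mem_rootSet α.2

/-- The embedding `k^Y → K` with `a ↦ α`. -/
def evalAt (α : c.f.rootSet K) : AdjoinRoot c.f →+* K :=
  AdjoinRoot.lift (algebraMap k K) (α : K) (c.eval_root α)

/-- The variety `X_{μ,α}` over `K`: the base change of the `k^Y`-scheme `Y` along `a ↦ α`. -/
def variety (α : c.f.rootSet K) : Scheme.{u} :=
  pullback c.toConst (Spec.map (CommRingCat.ofHom (c.evalAt α)))

/-- The structure morphism `X_{μ,α} → Spec K`. -/
def structMap (α : c.f.rootSet K) : c.variety α ⟶ Spec (.of K) := pullback.snd _ _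

/-- The projection `X_{μ,α} → Y`. -/
def toTotal (α : c.f.rootSet K) : c.variety α ⟶ c.Y := pullback.fst _ _

/-- The covering map `μ_α : X_{μ,α} → X`. -/
def covering (α : c.f.rootSet K) : c.variety α ⟶ X := c.toTotal α ≫ c.π

lemma evalAt_conj (σ : K ≃ₐ[k] K) {α α' : c.f.rootSet K} (h : (α' : K) = σ α) :
    CommRingCat.ofHom (c.evalAt α) ≫ CommRingCat.ofHom (σ : K →+* K) =
      CommRingCat.ofHom (c.evalAt α') := by
  rw [← CommRingCat.ofHom_comp]
  congr 1
  refine AdjoinRoot.ringHom_ext (RingHom.ext fun x => ?_) ?_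
  · simp [evalAt, AdjoinRoot.lift_of (c.eval_root α)]
  · simp [evalAt, AdjoinRoot.lift_root (c.eval_root α), h]

/-- For `α' = σ(α)`, the canonical isomorphism `X_{μ,α'} → X_{μ,α}` which is the identity on `Y`
and lies over `Spec σ`; it sends the conjugate `σ(x)` of a point `x` of `X_{μ,α}` to `x`. -/
def twist (σ : K ≃ₐ[k] K) {α α' : c.f.rootSet K} (h : (α' : K) = σ α) :
    c.variety α' ⟶ c.variety α :=
  pullback.lift (c.toTotal α') (c.structMap α' ≫ Spec.map (CommRingCat.ofHom (σ : K →+* K))) (by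
    rw [Category.assoc, ← Spec.map_comp, evalAt_conj c σ h]
    exact pullback.condition)

@[ext]
lemma variety_hom_ext {α : c.f.rootSet K} {Z : Scheme.{u}} {p q : Z ⟶ c.variety α}
    (h₁ : p ≫ c.toTotal α = q ≫ c.toTotal α) (h₂ : p ≫ c.structMap α = q ≫ c.structMap α) :
    p = q :=
  pullback.hom_ext h₁ h₂

@[simp]
lemma twist_toTotal (σ : K ≃ₐ[k] K) {α α' : c.f.rootSet K} (h : (α' : K) = σ α) :
    c.twist σ h ≫ c.toTotal α = c.toTotal α' :=
  pullback.lift_fst _ _ _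

@[simp]
lemma twist_structMap (σ : K ≃ₐ[k] K) {α α' : c.f.rootSet K} (h : (α' : K) = σ α) :
    c.twist σ h ≫ c.structMap α =
      c.structMap α' ≫ Spec.map (CommRingCat.ofHom (σ : K →+* K)) :=
  pullback.lift_snd _ _ _

lemma twist_one {α α' : c.f.rootSet K} (h : (α' : K) = (1 : K ≃ₐ[k] K) α) :
    c.twist 1 h = eqToHom (by rw [show α' = α from Subtype.ext h]) := by
  obtain rfl : α' = α := Subtype.ext h
  apply variety_hom_ext
  · simp
  · rw [twist_structMap]
    have : CommRingCat.ofHom (((1 : K ≃ₐ[k] K) : K ≃ₐ[k] K) : K →+* K) =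
        𝟙 (CommRingCat.of K) := rfl
    rw [this]
    simp

lemma twist_mul (σ τ : K ≃ₐ[k] K) {α α' α'' : c.f.rootSet K} (h : (α' : K) = τ α)
    (h' : (α'' : K) = σ α') (h'' : (α'' : K) = (σ * τ) α) :
    c.twist (σ * τ) h'' = c.twist σ h' ≫ c.twist τ h := by
  apply variety_hom_ext
  · simp
  · have : CommRingCat.ofHom ((σ * τ : K ≃ₐ[k] K) : K →+* K) =
        CommRingCat.ofHom (τ : K →+* K) ≫ CommRingCat.ofHom (σ : K →+* K) := rfl
    rw [twist_structMap, this, Spec.map_comp, Category.assoc, twist_structMap,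
      ← Category.assoc, ← Category.assoc, twist_structMap]

lemma twist_inv_comp (σ : K ≃ₐ[k] K) {α α' : c.f.rootSet K} (h : (α' : K) = σ α)
    (h' : (α : K) = σ⁻¹ α') : c.twist σ⁻¹ h' ≫ c.twist σ h = 𝟙 _ := by
  have e : (α : K) = (σ⁻¹ * σ) α := by simp
  have key : ∀ (τ : K ≃ₐ[k] K) (hτ : τ = 1) (e : (α : K) = τ α), c.twist τ e = 𝟙 _ := by
    rintro _ rfl e
    simpa using c.twist_one e
  have := c.twist_mul σ⁻¹ σ h h' e
  rw [← this]
  exact key _ (inv_mul_cancel σ) e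

lemma twist_comp_inv (σ : K ≃ₐ[k] K) {α α' : c.f.rootSet K} (h : (α' : K) = σ α)
    (h' : (α : K) = σ⁻¹ α') : c.twist σ h ≫ c.twist σ⁻¹ h' = 𝟙 _ := by
  have e : (α' : K) = (σ * σ⁻¹) α' := by simp
  have key : ∀ (τ : K ≃ₐ[k] K) (hτ : τ = 1) (e : (α' : K) = τ α'), c.twist τ e = 𝟙 _ := by
    rintro _ rfl e
    simpa using c.twist_one e
  have := c.twist_mul σ σ⁻¹ h' h e
  rw [← this]
  exact key _ (mul_inv_cancel σ) e

/-- `F`-points of the `K`-variety `X_{μ,α}`. -/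
def Points (α : c.f.rootSet K) (F : Type u) [Field F] [Algebra K F] : Type u :=
  {y : Spec (.of F) ⟶ c.variety α //
    y ≫ c.structMap α = Spec.map (CommRingCat.ofHom (algebraMap K F))}

/-- The inclusion `X_{μ,α}(F) ⊆ P^N(F)`. -/
def coords {α : c.f.rootSet K} {F : Type u} [Field F] [Algebra K F] (y : c.Points α F) :
    Projectivization F (Fin (N + 1) → F) :=
  homogeneousCoords (y.1 ≫ c.toTotal α ≫ c.emb)

end CoverPresentation

/-! ### Intermediate and distinguished morphisms -/

variable {M : Type v} (C : M → CoverPresentation s N) (K : Type u) [Field K] [Algebra k K]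

/-- The indices `(μ, α)` with `f_μ(α) = 0`. -/
abbrev Index : Type (max u v) := Σ μ : M, (C μ).f.rootSet K

variable {C K}

/-- The variety `X_{μ,α}`. -/
abbrev Var (i : Index C K) : Scheme.{u} := (C i.1).variety i.2

/-- An intermediate morphism `X_{μ,α} → X_{ν,β}`: a morphism of varieties over `K` which commutes
with the covering maps to `X`. (It is automatically étale.) -/
@[ext]
structure IntermediateMorphism (i j : Index C K) where
  hom : Var i ⟶ Var j
  hom_struct : hom ≫ (C j.1).structMap j.2 = (C i.1).structMap i.2
  hom_covering : hom ≫ (C j.1).covering j.2 = (C i.1).covering i.2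

namespace IntermediateMorphism

/-- The identity. -/
def id (i : Index C K) : IntermediateMorphism i i where
  hom := 𝟙 _
  hom_struct := Category.id_comp _
  hom_covering := Category.id_comp _

/-- Composition (first `p`, then `q`). -/
def comp {i j l : Index C K} (p : IntermediateMorphism i j) (q : IntermediateMorphism j l) :
    IntermediateMorphism i l where
  hom := p.hom ≫ q.hom
  hom_struct := by rw [Category.assoc, q.hom_struct, p.hom_struct]
  hom_covering := by rw [Category.assoc, q.hom_covering, p.hom_covering]

/-- `q : X_{μ,σ(α)} → X_{ν,σ(β)}` is the conjugate `p^σ` of `p : X_{μ,α} → X_{ν,β}`; on points,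
`q(σ(x)) = σ(p(x))`. -/
def IsConj (σ : K ≃ₐ[k] K) {μ ν : M} {α α' : (C μ).f.rootSet K} {β β' : (C ν).f.rootSet K}
    (hα : (α' : K) = σ α) (hβ : (β' : K) = σ β)
    (p : IntermediateMorphism (C := C) (K := K) ⟨μ, α⟩ ⟨ν, β⟩)
    (q : IntermediateMorphism (C := C) (K := K) ⟨μ, α'⟩ ⟨ν, β'⟩) : Prop :=
  q.hom ≫ (C ν).twist σ hβ = (C μ).twist σ hα ≫ p.hom

/-- The conjugate `p^σ` exists. -/
lemma exists_isConj (σ : K ≃ₐ[k] K) {μ ν : M} {α α' : (C μ).f.rootSet K}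
    {β β' : (C ν).f.rootSet K} (hα : (α' : K) = σ α) (hβ : (β' : K) = σ β)
    (p : IntermediateMorphism (C := C) (K := K) ⟨μ, α⟩ ⟨ν, β⟩) :
    ∃ q : IntermediateMorphism (C := C) (K := K) ⟨μ, α'⟩ ⟨ν, β'⟩, IsConj σ hα hβ p q := by
  have hβ' : (β : K) = σ⁻¹ β' := by
    rw [hβ]
    exact (σ.symm_apply_apply _).symm
  have hp1 := p.hom_struct
  have hp2 := p.hom_covering
  have hσ : Spec.map (CommRingCat.ofHom (σ : K →+* K)) ≫
      Spec.map (CommRingCat.ofHom ((σ⁻¹ : K ≃ₐ[k] K) : K →+* K)) = 𝟙 _ := by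
    rw [← Spec.map_comp, ← CommRingCat.ofHom_comp]
    have : (σ : K →+* K).comp ((σ⁻¹ : K ≃ₐ[k] K) : K →+* K) = RingHom.id K :=
      RingHom.ext fun x => σ.apply_symm_apply x
    rw [this]
    exact Spec.map_id _
  refine ⟨⟨(C μ).twist σ hα ≫ p.hom ≫ (C ν).twist σ⁻¹ hβ', ?_, ?_⟩, ?_⟩
  · simp only [Category.assoc, CoverPresentation.twist_structMap]
    rw [reassoc_of% hp1, ← Category.assoc, CoverPresentation.twist_structMap, Category.assoc, hσ,
      Category.comp_id]
  · simp only [Category.assoc, CoverPresentation.covering] at hp2 ⊢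
    rw [← Category.assoc ((C ν).twist _ _), CoverPresentation.twist_toTotal, hp2,
      ← Category.assoc, CoverPresentation.twist_toTotal]
  · simp only [IsConj, Category.assoc]
    rw [CoverPresentation.twist_inv_comp, Category.comp_id]

end IntermediateMorphism

variable (C K) in
/-- A projective system of distinguished morphisms: whenever an intermediate morphism
`X_{μ,α} → X_{ν,β}` exists, one of them is distinguished; the distinguished morphism from
`X_{μ,α}` to itself is the identity, and distinguished morphisms are closed under composition. -/
structure DistinguishedSystem where
  dist : ∀ {i j : Index C K}, Nonempty (IntermediateMorphism i j) → IntermediateMorphism i j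
  dist_self : ∀ (i : Index C K) (h : Nonempty (IntermediateMorphism i i)),
    dist h = IntermediateMorphism.id i
  dist_comp : ∀ {i j l : Index C K} (h : Nonempty (IntermediateMorphism i j))
    (h' : Nonempty (IntermediateMorphism j l)) (h'' : Nonempty (IntermediateMorphism i l)),
    (dist h).comp (dist h') = dist h''

/-- `σ` acts on the roots of a polynomial over `k`. -/
lemma exists_conj_root {L : Type u} [Field L] [Algebra k L] (σ : L ≃ₐ[k] L) {f : Polynomial k}
    (α : f.rootSet L) : ∃ α' : f.rootSet L, (α' : L) = σ α := by
  refine ⟨⟨σ α, ?_⟩, rfl⟩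
  have h := Polynomial.mem_rootSet.mp α.2
  refine Polynomial.mem_rootSet.mpr ⟨h.1, ?_⟩
  have e := Polynomial.aeval_algHom_apply (σ : L →ₐ[k] L) (α : L) f
  rw [h.2, map_zero] at e
  exact e

namespace DistinguishedSystem

variable (D : DistinguishedSystem C K)

/-- The group `G^♯` of all `σ ∈ Gal(K/k)` which preserve the family of distinguished morphisms:
the conjugate under `σ` of the distinguished morphism `X_{μ,α} → X_{ν,β}` is the distinguished
morphism `X_{μ,σ(α)} → X_{ν,σ(β)}`. -/
def gSharp : Subgroup (K ≃ₐ[k] K) where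
  carrier := {σ | ∀ (μ ν : M) (α α' : (C μ).f.rootSet K) (β β' : (C ν).f.rootSet K)
    (hα : (α' : K) = σ α) (hβ : (β' : K) = σ β)
    (h : Nonempty (IntermediateMorphism (C := C) (K := K) ⟨μ, α⟩ ⟨ν, β⟩))
    (h' : Nonempty (IntermediateMorphism (C := C) (K := K) ⟨μ, α'⟩ ⟨ν, β'⟩)),
    IntermediateMorphism.IsConj σ hα hβ (D.dist h) (D.dist h')}
  one_mem' := by
    intro μ ν α α' β β' hα hβ h h'
    obtain rfl : α' = α := Subtype.ext hα
    obtain rfl : β' = β := Subtype.ext hβ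
    simp [IntermediateMorphism.IsConj, CoverPresentation.twist_one]
  mul_mem' := by
    intro σ τ hσ hτ μ ν α α'' β β'' hα hβ h h''
    obtain ⟨α', hα'⟩ := exists_conj_root τ α
    obtain ⟨β', hβ'⟩ := exists_conj_root τ β
    obtain ⟨q, -⟩ := IntermediateMorphism.exists_isConj τ hα' hβ' h.some
    have hα'' : (α'' : K) = σ α' := by rw [hα, hα']; rfl
    have hβ'' : (β'' : K) = σ β' := by rw [hβ, hβ']; rfl
    have e1 := hτ μ ν α α' β β' hα' hβ' h ⟨q⟩
    have e2 := hσ μ ν α' α'' β' β'' hα'' hβ'' ⟨q⟩ h''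
    unfold IntermediateMorphism.IsConj at e1 e2 ⊢
    rw [(C ν).twist_mul σ τ hβ' hβ'', (C μ).twist_mul σ τ hα' hα'', ← Category.assoc, e2,
      Category.assoc, e1, Category.assoc]
  inv_mem' := by
    intro σ hσ μ ν α α' β β' hα hβ h h'
    have hα' : (α : K) = σ α' := by rw [hα]; exact (σ.apply_symm_apply _).symm
    have hβ' : (β : K) = σ β' := by rw [hβ]; exact (σ.apply_symm_apply _).symm
    have e := hσ μ ν α' α β' β hα' hβ' h' h
    unfold IntermediateMorphism.IsConj at e ⊢
    have e3 := (C μ).twist_inv_comp σ hα' hα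
    have e4 := (C ν).twist_comp_inv σ hβ' hβ
    calc (D.dist h').hom ≫ (C ν).twist σ⁻¹ hβ
        = ((C μ).twist σ⁻¹ hα ≫ (C μ).twist σ hα') ≫ (D.dist h').hom ≫
            (C ν).twist σ⁻¹ hβ := by rw [e3]; exact (Category.id_comp _).symm
      _ = (C μ).twist σ⁻¹ hα ≫ (D.dist h).hom ≫
            (C ν).twist σ hβ' ≫ (C ν).twist σ⁻¹ hβ := by
          rw [Category.assoc, ← Category.assoc ((C μ).twist σ hα'), ← e, Category.assoc]
      _ = (C μ).twist σ⁻¹ hα ≫ (D.dist h).hom := by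
          rw [e4, Category.comp_id]

/-- The field `k^♯` of all elements of `K` fixed by `G^♯`. -/
def kSharp : IntermediateField k K := IntermediateField.fixedField D.gSharp

/-! ### The étale cover and its automorphisms -/

variable (F : Type u) [Field F] [Algebra K F]

/-- The étale cover: the projective limit of the sets `X_{μ,α}(F)` along the
distinguished morphisms. -/
def Cover : Type (max u v) :=
  {u : ∀ i : Index C K, (C i.1).Points i.2 F //
    ∀ (i j : Index C K) (h : Nonempty (IntermediateMorphism i j)),
      (u i).1 ≫ (D.dist h).hom = (u j).1}

variable {F} in
/-- The roots in `F` of a polynomial over `k` lie in `K`. -/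
lemma exists_root_lift [IsAlgClosure k K] [Algebra k F] [IsScalarTower k K F] {f : Polynomial k}
    (α : f.rootSet F) : ∃ α₀ : f.rootSet K, algebraMap K F α₀ = α := by
  have : IsAlgClosed K := IsAlgClosure.isAlgClosed k
  have h := Polynomial.Splits.image_rootSet
    (IsAlgClosed.splits (f.map (algebraMap k K))) (IsScalarTower.toAlgHom k K F)
  obtain ⟨x, hx, hx'⟩ := h.ge α.2
  exact ⟨⟨x, hx⟩, hx'⟩

section

variable [IsAlgClosure k K] [Algebra k F] [IsScalarTower k K F]

/-- The map `p_μ : U × Zeros f_μ → P^N(F)`, `(u, α) ↦ p_{μ,α}(u)`, where `p_{μ,α}` is the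
projection of the limit `U` to `X_{μ,α}(F) ⊆ P^N(F)`. -/
def p (μ : M) (u : D.Cover F) (α : (C μ).f.rootSet F) : Projectivization F (Fin (N + 1) → F) :=
  (C μ).coords (u.1 ⟨μ, (exists_root_lift α).choose⟩)

/-- The automorphism group of the two-sorted structure with sorts `U` (the étale cover) and `F`
(with the ring operations and names for the elements of `k`) and the maps
`p_μ : U × Zeros f_μ → P^N(F)`. An automorphism is a pair consisting of a permutation of `U` and
an automorphism of `F` over `k` which together commute with all the maps `p_μ`. -/
def structureAut : Subgroup (Equiv.Perm (D.Cover F) × (F ≃ₐ[k] F)) where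
  carrier := {g | ∀ (μ : M) (u : D.Cover F) (α α' : (C μ).f.rootSet F), (α' : F) = g.2 α →
    D.p F μ (g.1 u) α' = projAct N g.2 (D.p F μ u α)}
  one_mem' := by
    intro μ u α α' h
    obtain rfl : α' = α := Subtype.ext h
    exact (projAct_one (k := k) _).symm
  mul_mem' := by
    intro g g' hg hg' μ u α α'' h
    obtain ⟨α', h'⟩ := exists_conj_root g'.2 α
    have h'' : (α'' : F) = g.2 α' := by rw [h, h']; rfl
    calc D.p F μ (g.1 (g'.1 u)) α'' = projAct N g.2 (D.p F μ (g'.1 u) α') := hg μ _ _ _ h''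
      _ = projAct N g.2 (projAct N g'.2 (D.p F μ u α)) := by rw [hg' μ _ _ _ h']
      _ = projAct N (g.2 * g'.2) (D.p F μ u α) := (projAct_mul _ _ _).symm
  inv_mem' := by
    intro g hg μ u α α' h
    have h' : (α : F) = g.2 α' := by rw [h]; exact (g.2.apply_symm_apply _).symm
    have e := hg μ (g.1⁻¹ u) α' α h'
    rw [show g.1 (g.1⁻¹ u) = u from g.1.apply_symm_apply u] at e
    change D.p F μ (g.1⁻¹ u) α' = projAct N g.2⁻¹ (D.p F μ u α)
    rw [e, ← projAct_mul, inv_mul_cancel, projAct_one]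

end

end DistinguishedSystem

end Covers

end EtaleCoverStructure

end

/-! Write `K` for the algebraic closure of `k`, and let `σ` be an automorphism of `F` over `k` with
restriction `τ` to `K`. Conjugation by `σ` carries points of `X_{μ,α}` to points of `X_{μ,τ(α)}` and
acts coordinatewise on `P^N(F)`. A point of `X_{μ,α}` is determined by its coordinates
(`coords_injective`), so commuting with the maps `p_μ` forces an automorphism with field part `σ` to
act on the limit by conjugation (`apply_eq_conj`). Hence restriction to the field sort is injective.

Such an automorphism exists exactly when conjugation preserves compatibility with the distinguished
morphisms. If `τ` is in `G^♯` this is immediate (`conjCover`). Conversely, an automorphism moves a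
compatible family to a compatible family, so a distinguished morphism and the conjugate it should
equal agree at one point. The source is connected and the covers are étale and separated, so they
coincide and `τ` is in `G^♯` (`mem_gSharp_of_structureAut`).

It remains to see that `τ` is in `G^♯` as soon as it fixes `k^♯`, that is, that `G^♯` is closed
(`mem_gSharp_of_fixes_kSharp`). Each condition defining `G^♯` can be tested at one `K`-point, hence
depends on finitely many values of `τ`, and infinite Galois theory applies.

Two geometric inputs remain. The varieties `X_{μ,α}` are connected because the field of constants is
integrally closed in the global functions (`connectedSpace_variety`). The limit is nonempty because
it contains a codirected limit of finite nonempty fibres (`nonempty_cover`). -/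

namespace EtaleCoverStructure

/-! ### Homogeneous coordinates: independence of the chart, injectivity, conjugation. -/

section ProjectivePoints

variable {k : Type u} [Field k] {N : ℕ} {F : Type u} [Field F]

/-- The function `x_j / x_i` on the chart `x_i ≠ 0` of projective space. -/
noncomputable def coordRatio (k : Type u) [Field k] {N : ℕ} (i j : Fin (N + 1)) :
    HomogeneousLocalization.Away (grading k N) (MvPolynomial.X i) :=
  HomogeneousLocalization.Away.mk (grading k N) (X_mem_grading i) 1
    (MvPolynomial.X j) (by simpa using X_mem_grading j)

lemma coordRatio_self (i : Fin (N + 1)) : coordRatio k i i = 1 := by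
  apply HomogeneousLocalization.val_injective
  rw [coordRatio, HomogeneousLocalization.Away.val_mk, HomogeneousLocalization.val_one]
  simp

/-- The open immersion of the chart `x_i ≠ 0`. -/
noncomputable abbrev chartι (k : Type u) [Field k] {N : ℕ} (i : Fin (N + 1)) :
    Spec (.of (HomogeneousLocalization.Away (grading k N) (MvPolynomial.X i))) ⟶ projSpace k N :=
  Proj.awayι (grading k N) (MvPolynomial.X i) (X_mem_grading i) one_pos

lemma chartHom_fac (y : Spec (.of F) ⟶ projSpace k N) :
    Spec.map (CommRingCat.ofHom (chartHom y)) ≫ chartι k (chart y) = y := by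
  rw [chartHom, CommRingCat.ofHom_hom, Spec.map_preimage]
  exact IsOpenImmersion.lift_fac _ _ _

/-- The transition formula `x_j/x_i = (x_j/x_l)(x_l/x_i)` on the overlap of two charts; it makes the
coordinate vectors computed in the two charts proportional. -/
lemma awayMap_coordRatio (i l j : Fin (N + 1)) :
    HomogeneousLocalization.awayMap (grading k N) (X_mem_grading l)
        (rfl : (MvPolynomial.X i * MvPolynomial.X l : MvPolynomial (Fin (N + 1)) k) = _)
        (coordRatio k i j) =
      HomogeneousLocalization.awayMap (grading k N) (X_mem_grading i)
        (mul_comm _ _ : (MvPolynomial.X i * MvPolynomial.X l : MvPolynomial (Fin (N + 1)) k) = _)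
          (coordRatio k l j) *
      HomogeneousLocalization.awayMap (grading k N) (X_mem_grading l)
        (rfl : (MvPolynomial.X i * MvPolynomial.X l : MvPolynomial (Fin (N + 1)) k) = _)
        (coordRatio k i l) := by
  apply HomogeneousLocalization.val_injective
  simp only [coordRatio, HomogeneousLocalization.awayMap_mk, HomogeneousLocalization.val_mul,
    HomogeneousLocalization.Away.val_mk, Localization.mk_mul, Localization.mk_eq_mk_iff,
    Localization.r_iff_exists]
  refine ⟨1, ?_⟩
  simp
  ring

/-- A point of the chart `x_l ≠ 0` at which `x_i / x_l` does not vanish also lies in the chart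
`x_i ≠ 0`, and its coordinates there differ by a scalar. -/
lemma exists_change_chart {l : Fin (N + 1)}
    (φ : HomogeneousLocalization.Away (grading k N) (MvPolynomial.X l) →+* F) (i : Fin (N + 1))
    (h : φ (coordRatio k l i) ≠ 0) :
    ∃ ψ : HomogeneousLocalization.Away (grading k N) (MvPolynomial.X i) →+* F,
      Spec.map (CommRingCat.ofHom ψ) ≫ chartι k i = Spec.map (CommRingCat.ofHom φ) ≫ chartι k l ∧
      ∀ j, φ (coordRatio k l j) = φ (coordRatio k l i) * ψ (coordRatio k i j) := by
  let := (HomogeneousLocalization.awayMap (grading k N) (X_mem_grading i)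
    (rfl : (MvPolynomial.X l * MvPolynomial.X i : MvPolynomial (Fin (N + 1)) k) = _)).toAlgebra
  -- The ring of the overlap is the localization of the ring of the chart `x_l ≠ 0` at `x_i / x_l`,
  -- so `φ` extends to it once its value there is a unit.
  have hloc := HomogeneousLocalization.Away.isLocalization_mul (X_mem_grading (k := k) l)
    (X_mem_grading (k := k) i)
    (rfl : (MvPolynomial.X l * MvPolynomial.X i : MvPolynomial (Fin (N + 1)) k) = _) one_ne_zero
  have hu : IsUnit (φ (HomogeneousLocalization.Away.isLocalizationElem (X_mem_grading (k := k) l)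
    (X_mem_grading (k := k) i))) := by
    have : HomogeneousLocalization.Away.isLocalizationElem (X_mem_grading (k := k) l)
      (X_mem_grading (k := k) i) = coordRatio k l i := by
      apply HomogeneousLocalization.val_injective
      simp [coordRatio, HomogeneousLocalization.Away.val_mk]
    rw [this]
    exact h.isUnit
  let χ := IsLocalization.Away.lift (S := HomogeneousLocalization.Away (grading k N)
    (MvPolynomial.X l * MvPolynomial.X i)) _ hu
  have hχ : ∀ x, χ (HomogeneousLocalization.awayMap (grading k N) (X_mem_grading i)
    (rfl : (MvPolynomial.X l * MvPolynomial.X i : MvPolynomial (Fin (N + 1)) k) = _) x) = φ x :=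
    fun x => IsLocalization.Away.lift_eq _ hu x
  refine ⟨χ.comp (HomogeneousLocalization.awayMap (grading k N) (X_mem_grading l)
    (mul_comm _ _ : (MvPolynomial.X l * MvPolynomial.X i : MvPolynomial (Fin (N + 1)) k) = _)),
    ?_, fun j => ?_⟩
  · have e : φ = χ.comp (HomogeneousLocalization.awayMap (grading k N) (X_mem_grading i)
      (rfl : (MvPolynomial.X l * MvPolynomial.X i : MvPolynomial (Fin (N + 1)) k) = _)) :=
      RingHom.ext fun x => (hχ x).symm
    conv_rhs => rw [e]
    rw [CommRingCat.ofHom_comp, CommRingCat.ofHom_comp, Spec.map_comp, Spec.map_comp,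
      Category.assoc, Category.assoc, Proj.SpecMap_awayMap_awayι, Proj.SpecMap_awayMap_awayι]
  · rw [← hχ, ← hχ, awayMap_coordRatio, map_mul, mul_comm]
    rfl

lemma coordVector_eq_of_chart {y : Spec (.of F) ⟶ projSpace k N} {i : Fin (N + 1)}
    {φ : HomogeneousLocalization.Away (grading k N) (MvPolynomial.X i) →+* F}
    (h : Spec.map (CommRingCat.ofHom φ) ≫ chartι k i = y) (hi : chart y = i) :
    coordVector y = fun j => φ (coordRatio k i j) := by
  subst hi
  have : chartHom y = φ := by
    have e := (chartHom_fac y).trans h.symm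
    rw [cancel_mono] at e
    exact congrArg CommRingCat.Hom.hom (Spec.map_injective e)
  rw [← this]
  rfl

/-- The homogeneous coordinates of a point can be computed in any chart. -/
lemma homogeneousCoords_eq {y : Spec (.of F) ⟶ projSpace k N} {i : Fin (N + 1)}
    {φ : HomogeneousLocalization.Away (grading k N) (MvPolynomial.X i) →+* F}
    (h : Spec.map (CommRingCat.ofHom φ) ≫ chartι k i = y) :
    homogeneousCoords y = Projectivization.mk F (fun j => φ (coordRatio k i j))
      (fun h0 => by simpa [coordRatio_self] using congrFun h0 i) := by
  -- The point lies in its chosen chart, whose trace on the chart `x_i ≠ 0` is the nonvanishing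
  -- locus of this ratio.
  have hne : φ (coordRatio k i (chart y)) ≠ 0 := by
    intro h0
    have hmem : y (IsLocalRing.closedPoint F) ∈
        Proj.basicOpen (grading k N) (MvPolynomial.X (chart y)) :=
      (exists_chart (y (IsLocalRing.closedPoint F))).choose_spec
    have hmem' : (Spec.map (CommRingCat.ofHom φ)) (IsLocalRing.closedPoint F) ∈
        (chartι k i) ⁻¹ᵁ Proj.basicOpen (grading k N) (MvPolynomial.X (chart y)) := by
      subst h
      have key (p : Spec (.of F)) (U : (projSpace k N).Opens)
          (hp : (Spec.map (CommRingCat.ofHom φ) ≫ chartι k i) p ∈ U) :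
          (Spec.map (CommRingCat.ofHom φ)) p ∈ (chartι k i) ⁻¹ᵁ U := by
        rw [Scheme.Hom.comp_apply] at hp
        exact hp
      exact key _ _ hmem
    rw [Proj.awayι_preimage_basicOpen (grading k N) (X_mem_grading i) one_pos
      (X_mem_grading (chart y)) one_pos] at hmem'
    apply hmem'
    have : HomogeneousLocalization.Away.isLocalizationElem (X_mem_grading (k := k) i)
      (X_mem_grading (k := k) (chart y)) = coordRatio k i (chart y) := by
      apply HomogeneousLocalization.val_injective
      simp [coordRatio, HomogeneousLocalization.Away.val_mk]
    rw [this]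
    change φ _ ∈ (IsLocalRing.closedPoint F).asIdeal
    rw [h0]
    exact zero_mem _
  obtain ⟨ψ, hψ, hr⟩ := exists_change_chart φ (chart y) hne
  rw [homogeneousCoords, Projectivization.mk_eq_mk_iff']
  refine ⟨(φ (coordRatio k i (chart y)))⁻¹, ?_⟩
  rw [coordVector_eq_of_chart (hψ.trans h) rfl]
  ext j
  simp [hr j, hne]

lemma adjoin_X_eq_top : Algebra.adjoin (grading k N 0)
    (Set.range fun j : Fin (N + 1) => (MvPolynomial.X j : MvPolynomial (Fin (N + 1)) k)) = ⊤ := by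
  rw [eq_top_iff]
  rintro f -
  induction f using MvPolynomial.induction_on with
  | C a =>
    exact Subalgebra.algebraMap_mem (Algebra.adjoin (grading k N 0) _)
      (algebraMap k (grading k N 0) a)
  | add p q hp hq => exact add_mem hp hq
  | mul_X p i hp => exact mul_mem hp (Algebra.subset_adjoin ⟨i, rfl⟩)

/-- A ring homomorphism over `k` from the coordinate ring of a chart is determined by the values
of the coordinates. -/
lemma chart_ringHom_ext {i : Fin (N + 1)}
    {φ ψ : HomogeneousLocalization.Away (grading k N) (MvPolynomial.X i) →+* F}
    (h₀ : ∀ a, φ (HomogeneousLocalization.fromZeroRingHom _ _ (algebraMap k (grading k N 0) a)) =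
      ψ (HomogeneousLocalization.fromZeroRingHom _ _ (algebraMap k (grading k N 0) a)))
    (h : ∀ j, φ (coordRatio k i j) = ψ (coordRatio k i j)) : φ = ψ := by
  have h₀' : ∀ a : grading k N 0, φ (algebraMap (grading k N 0) _ a) =
      ψ (algebraMap (grading k N 0) _ a) := by
    intro a
    have : a = algebraMap k (grading k N 0) (MvPolynomial.coeff 0 a.1) := by
      apply Subtype.ext
      have := a.2
      rw [MvPolynomial.mem_homogeneousSubmodule, ← MvPolynomial.totalDegree_zero_iff_isHomogeneous] at this
      exact MvPolynomial.totalDegree_eq_zero_iff_eq_C.mp this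
    rw [this]
    exact h₀ _
  let E : Subalgebra (grading k N 0)
      (HomogeneousLocalization.Away (grading k N) (MvPolynomial.X i)) :=
    { (RingHom.eqLocus φ ψ).toSubsemiring with algebraMap_mem' := h₀' }
  -- The chart ring is generated over degree zero by monomials divided by powers of `x_i`, and each
  -- of these is a product of ratios `x_j / x_i`.
  have hE : E = ⊤ := by
    rw [← top_le_iff, ← HomogeneousLocalization.Away.adjoin_mk_prod_pow_eq_top
      (X_mem_grading (k := k) i) (Fin (N + 1)) (fun j => MvPolynomial.X j) adjoin_X_eq_top
      (fun _ => 1) (fun j => X_mem_grading j), Algebra.adjoin_le_iff]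
    rintro _ ⟨a, ai, hai, -, rfl⟩
    have hai' : ∑ j, ai j = a := by simpa using hai
    have hE : ∀ j, coordRatio k i j ∈ E := h
    suffices e : HomogeneousLocalization.Away.mk (grading k N) (X_mem_grading (k := k) i) a
        (∏ j, MvPolynomial.X j ^ ai j) (hai ▸ SetLike.prod_pow_mem_graded _ _ _ _
          fun j _ => X_mem_grading j) = ∏ j, coordRatio k i j ^ ai j by
      rw [SetLike.mem_coe, e]
      exact Subalgebra.prod_mem E fun j _ => pow_mem (hE j) (ai j)
    apply HomogeneousLocalization.val_injective
    rw [← HomogeneousLocalization.algebraMap_apply, ← HomogeneousLocalization.algebraMap_apply,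
      map_prod]
    simp only [map_pow, HomogeneousLocalization.algebraMap_apply, coordRatio,
      HomogeneousLocalization.Away.val_mk, Localization.mk_pow, Localization.mk_prod, 
      Localization.mk_eq_mk_iff, Localization.r_iff_exists]
    refine ⟨1, ?_⟩
    simp [Finset.prod_pow_eq_pow_sum, hai']
  exact RingHom.ext fun x => show x ∈ E from hE ▸ Algebra.mem_top

variable [Algebra k F]

lemma algebraMap_of_over {i : Fin (N + 1)}
    {φ : HomogeneousLocalization.Away (grading k N) (MvPolynomial.X i) →+* F}
    (h : (Spec.map (CommRingCat.ofHom φ) ≫ chartι k i) ≫ projSpaceToSpec k N =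
      Spec.map (CommRingCat.ofHom (algebraMap k F))) (a : k) :
    φ (HomogeneousLocalization.fromZeroRingHom _ _ (algebraMap k (grading k N 0) a)) =
      algebraMap k F a := by
  rw [projSpaceToSpec, Category.assoc, Proj.awayι_toSpecZero_assoc, ← Spec.map_comp,
    ← Spec.map_comp] at h
  exact congrArg (fun f => f.hom a) (Spec.map_injective h)

/-- A point of projective space over `k` is determined by its homogeneous coordinates. -/
lemma homogeneousCoords_injective {y z : Spec (.of F) ⟶ projSpace k N}
    (hy : y ≫ projSpaceToSpec k N = Spec.map (CommRingCat.ofHom (algebraMap k F)))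
    (hz : z ≫ projSpaceToSpec k N = Spec.map (CommRingCat.ofHom (algebraMap k F)))
    (h : homogeneousCoords y = homogeneousCoords z) : y = z := by
  set i := chart y with hi
  have hy' := chartHom_fac y
  have hz' := chartHom_fac z
  set φ := chartHom y
  set ψ := chartHom z
  rw [homogeneousCoords_eq hy', homogeneousCoords_eq hz', Projectivization.mk_eq_mk_iff'] at h
  obtain ⟨c, hc⟩ := h
  replace hc := fun j => congrFun hc j
  simp only [Pi.smul_apply, smul_eq_mul] at hc
  -- The coordinate vector of `y` has entry `1` at `i`, so the proportional vector of `z` is nonzero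
  -- there. Both points can then be compared in one chart, where entry `1` at `i` fixes the scalar.
  have hne : ψ (coordRatio k (chart z) i) ≠ 0 := by
    intro h0
    have := hc i
    rw [h0, coordRatio_self, map_one, mul_zero] at this
    exact zero_ne_one this
  obtain ⟨ψ', h', hr⟩ := exists_change_chart ψ i hne
  have hz'' := h'.trans hz'
  have : φ = ψ' := by
    refine chart_ringHom_ext (fun a => ?_) fun j => ?_
    · rw [algebraMap_of_over (by rw [hy', hy]), algebraMap_of_over (by rw [hz'', hz])]
    · have h1 := hc i
      rw [coordRatio_self, map_one] at h1
      rw [← hc j, hr j, ← mul_assoc, h1, one_mul]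
  rw [← hy', ← hz'', this]

/-- The homogeneous coordinates of the conjugate of a point. -/
lemma homogeneousCoords_conj (σ : F ≃ₐ[k] F) (y : Spec (.of F) ⟶ projSpace k N) :
    homogeneousCoords (Spec.map (CommRingCat.ofHom (σ : F →+* F)) ≫ y) =
      projAct N σ (homogeneousCoords y) := by
  have h := chartHom_fac y
  have h' : Spec.map (CommRingCat.ofHom ((σ : F →+* F).comp (chartHom y))) ≫ chartι k (chart y) =
      Spec.map (CommRingCat.ofHom (σ : F →+* F)) ≫ y := by
    rw [CommRingCat.ofHom_comp, Spec.map_comp, Category.assoc, h]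
  rw [homogeneousCoords_eq h, homogeneousCoords_eq h']
  rfl

end ProjectivePoints

/-! ### Idempotents in base changes along algebraic extensions. -/

section Idempotents

open TensorProduct

variable {L : Type u} [Field L] {A : Type u} [CommRing A] [Algebra L A]

lemma isIntegral_of_isIdempotentElem {R S : Type*} [CommRing R] [CommRing S] [Algebra R S] {x : S}
    (hx : IsIdempotentElem x) : IsIntegral R x := by
  nontriviality R
  refine ⟨Polynomial.X ^ 2 - Polynomial.X, ?_, ?_⟩
  · exact Polynomial.monic_X_pow_sub (by simp)
  · simp [pow_two, hx.eq]

/-- If `L` is integrally closed in `A`, then the same holds after a finite separable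
base change. -/
lemma isIntegral_baseChange_mem_range (hA : ∀ a : A, IsIntegral L a → ∃ l, algebraMap L A l = a)
    {L' : Type u} [Field L'] [Algebra L L'] [FiniteDimensional L L'] [Algebra.IsSeparable L L']
    (e : L' ⊗[L] A) (he : IsIntegral L' e) : ∃ l : L', e = l ⊗ₜ 1 := by
  have : Algebra.FormallyEtale L L' := Algebra.FormallyEtale.of_isSeparable L L'
  have : Algebra.Etale L L' :=
    ⟨inferInstance, Algebra.FinitePresentation.of_finiteType.mp inferInstance⟩
  -- Integral closure commutes with étale base change, so `e` comes from `L'` tensored with the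
  -- integral closure of `L` in `A`, which is the image of `L`.
  obtain ⟨x, hx⟩ := (TensorProduct.toIntegralClosure_bijective_of_smooth (R := L) (S := L')
    (B := A)).2 ⟨e, he⟩
  have hx' := congrArg Subtype.val hx
  change (TensorProduct.toIntegralClosure L L' A x).1 = e at hx'
  rw [← hx']
  clear hx hx' he
  induction x using TensorProduct.induction_on with
  | zero => exact ⟨0, by simp⟩
  | add x y hx hy =>
    obtain ⟨l, hl⟩ := hx
    obtain ⟨m, hm⟩ := hy
    exact ⟨l + m, by rw [map_add, Subalgebra.coe_add, hl, hm, TensorProduct.add_tmul]⟩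
  | tmul l a =>
    obtain ⟨m, hm⟩ := hA a.1 a.2
    refine ⟨m • l, ?_⟩
    change l ⊗ₜ[L] a.1 = _
    rw [← hm, Algebra.algebraMap_eq_smul_one, TensorProduct.tmul_smul, TensorProduct.smul_tmul']

/-- A tensor involves only finitely many elements of `K`. This reduces algebraic separable
extensions to finite ones, which are étale. -/
lemma exists_finite_subextension {K : Type u} [Field K] [Algebra L K] [Algebra.IsAlgebraic L K]
    (e : K ⊗[L] A) : ∃ (E : IntermediateField L K), FiniteDimensional L E ∧
      e ∈ (Algebra.TensorProduct.map E.val (AlgHom.id L A)).range := by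
  induction e using TensorProduct.induction_on with
  | zero => exact ⟨⊥, inferInstance, zero_mem _⟩
  | tmul x a =>
    have := IntermediateField.adjoin.finiteDimensional (Algebra.IsIntegral.isIntegral (R := L) x)
    exact ⟨IntermediateField.adjoin L {x}, this,
      ⟨⟨x, IntermediateField.mem_adjoin_simple_self L x⟩ ⊗ₜ a, rfl⟩⟩
  | add x y hx hy =>
    obtain ⟨E, hE, x, rfl⟩ := hx
    obtain ⟨E', hE', y, rfl⟩ := hy
    have mono (E₁ E₂ : IntermediateField L K) (h : E₁ ≤ E₂) (x : E₁ ⊗[L] A) :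
        Algebra.TensorProduct.map E₁.val (AlgHom.id L A) x ∈
          (Algebra.TensorProduct.map E₂.val (AlgHom.id L A)).range := by
      refine ⟨Algebra.TensorProduct.map (IntermediateField.inclusion h) (AlgHom.id L A) x, ?_⟩
      induction x using TensorProduct.induction_on with
      | zero => simp
      | tmul x y => rfl
      | add x y hx hy => simp only [map_add]; exact congrArg₂ _ hx hy
    exact ⟨E ⊔ E', inferInstance, add_mem (mono _ _ le_sup_left x) (mono _ _ le_sup_right y)⟩

/-- If `L` is integrally closed in the nontrivial ring `A`, then the base change of `A` to an
algebraic separable extension of `L` has only the trivial idempotents. -/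
lemma idempotent_baseChange_trivial [Nontrivial A]
    (hA : ∀ a : A, IsIntegral L a → ∃ l, algebraMap L A l = a)
    {K : Type u} [Field K] [Algebra L K] [Algebra.IsAlgebraic L K] [Algebra.IsSeparable L K]
    (e : K ⊗[L] A) (he : IsIdempotentElem e) : e = 0 ∨ e = 1 := by
  obtain ⟨E, hE, x, rfl⟩ := exists_finite_subextension e
  have hinj : Function.Injective (Algebra.TensorProduct.map E.val (AlgHom.id L A)) :=
    Module.Flat.rTensor_preserves_injective_linearMap (M := A) E.val.toLinearMap
      E.val.toRingHom.injective
  have hx : IsIdempotentElem x := hinj (by rw [map_mul]; exact he)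
  -- Idempotents are integral, being roots of `T^2 - T`; so `x` comes from the field `E`, where only
  -- `0` and `1` are idempotent.
  obtain ⟨l, rfl⟩ := isIntegral_baseChange_mem_range hA x (isIntegral_of_isIdempotentElem hx)
  have hinj' : Function.Injective
      (Algebra.TensorProduct.includeLeft : E →ₐ[L] E ⊗[L] A) :=
    Algebra.TensorProduct.includeLeft_injective (algebraMap L A).injective
  have hl : IsIdempotentElem l := hinj' (by
    rw [map_mul]
    exact hx)
  rcases IsIdempotentElem.iff_eq_zero_or_one.mp hl with rfl | rfl
  · left; simp
  · right; exact map_one _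

end Idempotents

/-! ### Connectedness from global functions. -/

section Connected

/-- A nontrivial clopen decomposition `T = U ⊔ V` splits the global functions as a product of two
nonzero rings, and `(1, 0)` is then a nontrivial idempotent. -/
lemma connectedSpace_of_trivial_idempotents {T : Scheme.{u}} [Nonempty T]
    (h : ∀ e : Γ(T, ⊤), IsIdempotentElem e → e = 0 ∨ e = 1) : ConnectedSpace T := by
  have : PreconnectedSpace T := by
    rw [preconnectedSpace_iff_clopen]
    intro s hs
    by_contra! hcon
    let U : T.Opens := ⟨s, hs.isOpen⟩
    let V : T.Opens := ⟨sᶜ, hs.compl.isOpen⟩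
    have hU : Nonempty U := hcon.1.to_subtype
    have hV : Nonempty V := (Set.nonempty_compl.mpr hcon.2).to_subtype
    have hUV : U ⊔ V = ⊤ := by
      ext x
      simp [U, V]
    have hd : U ⊓ V = ⊥ := by
      ext x
      simp [U, V]
    have h' : ∀ (W : T.Opens), W = ⊤ → ∀ e : Γ(T, W), IsIdempotentElem e → e = 0 ∨ e = 1 := by
      rintro _ rfl
      exact h
    let e : Γ(T, U ⊔ V) ≅ CommRingCat.of (Γ(T, U) × Γ(T, V)) :=
      (T.sheaf.isProductOfDisjoint U V hd).conePointUniqueUpToIso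
        (CommRingCat.prodFanIsLimit _ _)
    let e' := e.symm.commRingCatIsoToRingEquiv
    have hid : IsIdempotentElem (e' ((1, 0) : Γ(T, U) × Γ(T, V))) := by
      rw [IsIdempotentElem, ← map_mul]
      simp
    rcases h' _ hUV _ hid with h0 | h1
    · rw [map_eq_zero_iff e' e'.injective] at h0
      exact one_ne_zero (congrArg Prod.fst h0)
    · rw [map_eq_one_iff e' e'.injective] at h1
      exact zero_ne_one (congrArg Prod.snd h1)
  exact ⟨inferInstance⟩

open TensorProduct in
/-- If the field `L` is integrally closed in the ring of global functions of the `L`-scheme `Y`,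
then the base change of `Y` to an algebraic separable extension of `L` is connected. -/
lemma connectedSpace_baseChange {L K : Type u} [Field L] [Field K] [Algebra L K]
    [Algebra.IsAlgebraic L K] [Algebra.IsSeparable L K] {Y : Scheme.{u}} [Nonempty Y]
    [CompactSpace Y] [QuasiSeparatedSpace Y] (t : Y ⟶ Spec (.of L))
    (h : ∀ b, (constMap t).IsIntegralElem b → ∃ l, constMap t l = b) :
    ConnectedSpace ↥(pullback t (Spec.map (CommRingCat.ofHom (algebraMap L K)))) := by
  let f := Spec.map (CommRingCat.ofHom (algebraMap L K))
  have hflat : Flat f := by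
    rw [HasRingHomProperty.Spec_iff (P := @Flat)]
    exact RingHom.flat_algebraMap_iff.mpr inferInstance
  -- Flat base change for the quasi-compact quasi-separated `Y`: the global functions of the fibre
  -- product are `K ⊗[L] Γ(Y, ⊤)`.
  have hiso := isIso_pushoutSection_of_isQuasiSeparated_of_flat_right
    (IsPullback.of_hasPullback t f) (US := ⊤) (UT := ⊤) (UX := ⊤) le_top le_top (UY := ⊤) (by simp)
    (isAffineOpen_top _) (isAffineOpen_top _) isCompact_univ isQuasiSeparated_univ
  replace hiso := (isIso_pushoutSection_iff _ _ _ _).mp hiso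
  let := (constMap t).toAlgebra
  have hp : IsPushout (CommRingCat.ofHom (algebraMap L K))
      (CommRingCat.ofHom (algebraMap L Γ(Y, ⊤)))
      ((Scheme.ΓSpecIso (.of K)).inv ≫ (pullback.snd t f).appTop)
      (pullback.fst t f).appTop := by
    refine IsPushout.of_iso hiso.flip (Scheme.ΓSpecIso (.of L)) (Scheme.ΓSpecIso (.of K))
      (Iso.refl _) (Iso.refl _) ?_ ?_ ?_ ?_
    · rw [show f.appLE ⊤ ⊤ le_top = f.appTop from f.app_eq_appLE.symm]
      exact Scheme.ΓSpecIso_naturality _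
    · rw [show t.appLE ⊤ ⊤ le_top = t.appTop from t.app_eq_appLE.symm]
      change _ = _ ≫ (Scheme.ΓSpecIso (.of L)).inv ≫ t.appTop
      simp
    · rw [Iso.hom_inv_id_assoc]
      exact (Category.comp_id _).trans (pullback.snd t f).app_eq_appLE.symm
    · exact (Category.comp_id _).trans
        ((pullback.fst t f).app_eq_appLE.symm.trans (Category.id_comp _).symm)
  let e := (hp.isoIsPushout _ _ 
    (CommRingCat.isPushout_tensorProduct L K Γ(Y, ⊤))).commRingCatIsoToRingEquiv
  have : Nonempty (⊤ : Y.Opens) := ⟨⟨Classical.arbitrary Y, trivial⟩⟩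
  have : Nontrivial Γ(Y, ⊤) := Scheme.component_nontrivial Y ⊤
  have : Nonempty ↥(pullback t f) := inferInstance
  refine connectedSpace_of_trivial_idempotents fun x hx => ?_
  rcases idempotent_baseChange_trivial (L := L) (A := Γ(Y, ⊤)) (K := K) h (e x)
    (hx.map e) with h0 | h1
  · left
    exact (map_eq_zero_iff e e.injective).mp h0
  · right
    exact (map_eq_one_iff e e.injective).mp h1

end Connected

/-! ### Noetherianity of quasi-projective schemes. -/

section Noetherian

variable {k : Type u} [Field k] {N : ℕ}

lemma algebraMap_grading_zero_bijective :
    Function.Bijective (algebraMap k (grading k N 0)) := by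
  refine ⟨fun a b h => MvPolynomial.C_injective (Fin (N + 1)) k (congrArg Subtype.val h),
    fun a => ⟨MvPolynomial.coeff 0 a.1, ?_⟩⟩
  apply Subtype.ext
  have := a.2
  rw [MvPolynomial.mem_homogeneousSubmodule,
    ← MvPolynomial.totalDegree_zero_iff_isHomogeneous] at this
  exact (MvPolynomial.totalDegree_eq_zero_iff_eq_C.mp this).symm

instance isNoetherian_projSpace : IsNoetherian (projSpace k N) := by
  have : Algebra.FiniteType (grading k N 0) (MvPolynomial (Fin (N + 1)) k) := by
    classical
    refine ⟨⟨Finset.univ.image fun j => MvPolynomial.X j, ?_⟩⟩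
    rw [Finset.coe_image, Finset.coe_univ, Set.image_univ]
    exact adjoin_X_eq_top
  have : IsNoetherianRing (grading k N 0) :=
    isNoetherianRing_of_surjective k _ _ algebraMap_grading_zero_bijective.2
  have : IsLocallyNoetherian (projSpace k N) :=
    LocallyOfFiniteType.isLocallyNoetherian (Proj.toSpecZero (grading k N))
  have : CompactSpace (projSpace k N) :=
    QuasiCompact.compactSpace_of_compactSpace (Proj.toSpecZero (grading k N))
  exact {}

/-- Subspaces of a noetherian space are noetherian. This supplies the quasi-compactness of `X`, and
so of the covers finite over it. -/
lemma IsQuasiProjective.noetherianSpace {X : Scheme.{u}} {s : X ⟶ Spec (.of k)}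
    (h : IsQuasiProjective s) : TopologicalSpace.NoetherianSpace X := by
  obtain ⟨n, j, hj, -⟩ := h
  exact j.isEmbedding.isInducing.noetherianSpace

end Noetherian

/-! ### Constants of a cover, and the points of `X_{μ,α}`. -/

namespace CoverPresentation

variable {k : Type u} [Field k] {X : Scheme.{u}} {s : X ⟶ Spec (.of k)} {N : ℕ}
  (c : CoverPresentation s N) {K : Type u} [Field K] [Algebra k K]

instance : Fact (Irreducible c.f) := ⟨c.irreducible⟩

instance : IsFinite c.π := c.isGaloisCover.isFinite
instance : Etale c.π := c.isGaloisCover.etale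
instance : ConnectedSpace c.Y := c.isGaloisCover.connected

instance : Nontrivial Γ(c.Y, ⊤) := by
  have : Nonempty (⊤ : c.Y.Opens) := ⟨⟨Classical.arbitrary c.Y, trivial⟩⟩
  exact Scheme.component_nontrivial c.Y ⊤

lemma constMap_toConst :
    constMap c.toConst = AdjoinRoot.lift (constMap (c.π ≫ s)) c.a c.eval_a := by
  rw [constMap, toConst, toConstants, Scheme.Hom.comp_appTop, Scheme.toSpecΓ_appTop,
    Scheme.ΓSpecIso_naturality, Iso.inv_hom_id_assoc, CommRingCat.hom_ofHom]

lemma isIntegral_of : (AdjoinRoot.of c.f).IsIntegral := by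
  have := c.monic.finite_adjoinRoot
  exact fun x => Algebra.IsIntegral.isIntegral x

/-- The field of constants is integrally closed in the ring of global functions. -/
lemma mem_range_constMap_toConst (b : Γ(c.Y, ⊤)) (hb : (constMap c.toConst).IsIntegralElem b) :
    ∃ l, constMap c.toConst l = b := by
  rw [constMap_toConst] at hb ⊢
  have h : (constMap (c.π ≫ s)).IsIntegralElem b := by
    have e : (AdjoinRoot.lift (constMap (c.π ≫ s)) c.a c.eval_a).comp (AdjoinRoot.of c.f) =
      constMap (c.π ≫ s) := RingHom.ext fun x => AdjoinRoot.lift_of c.eval_a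
    let := (constMap (c.π ≫ s)).toAlgebra
    let := (AdjoinRoot.lift (constMap (c.π ≫ s)) c.a c.eval_a).toAlgebra
    have : IsScalarTower k (AdjoinRoot c.f) Γ(c.Y, ⊤) := .of_algebraMap_eq' e.symm
    have : Algebra.IsIntegral k (AdjoinRoot c.f) := ⟨c.isIntegral_of⟩
    exact isIntegral_trans (A := AdjoinRoot c.f) b hb
  obtain ⟨g, hg⟩ := c.generates b h
  exact ⟨AdjoinRoot.mk c.f g, by rw [AdjoinRoot.lift_mk, hg]⟩

/-- The field of constants is integrally closed in the global functions of `Y`, and `K` is algebraic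
over it, hence separable in characteristic zero; so the base change acquires no new idempotents. -/
lemma connectedSpace_variety [CharZero k] [Algebra.IsAlgebraic k K] [CompactSpace c.Y]
    [QuasiSeparatedSpace c.Y] (α : c.f.rootSet K) : ConnectedSpace ↥(c.variety α) := by
  let := (c.evalAt α).toAlgebra
  have : IsScalarTower k (AdjoinRoot c.f) K :=
    .of_algebraMap_eq fun x => (AdjoinRoot.lift_of (c.eval_root α)).symm
  have : Algebra.IsAlgebraic (AdjoinRoot c.f) K := Algebra.IsAlgebraic.tower_top (K := k) _
  have : CharZero (AdjoinRoot c.f) := algebraRat.charZero _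
  exact connectedSpace_baseChange c.toConst c.mem_range_constMap_toConst

variable {c} {F : Type u} [Field F] [Algebra K F]

/-- The image in `Y_μ` of a point of `X_{μ,α}`. -/
noncomputable def Points.total {α : c.f.rootSet K} (y : c.Points α F) : Spec (.of F) ⟶ c.Y :=
  y.1 ≫ c.toTotal α

lemma Points.total_toConst {α : c.f.rootSet K} (y : c.Points α F) :
    y.total ≫ c.toConst =
      Spec.map (CommRingCat.ofHom ((algebraMap K F).comp (c.evalAt α))) := by
  have h : c.toTotal α ≫ c.toConst = c.structMap α ≫ _ := pullback.condition
  rw [total, Category.assoc, h, reassoc_of% y.2, ← Spec.map_comp, ← CommRingCat.ofHom_comp]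

/-- The point of `X_{μ,α}` given by a point of `Y_μ` at which `a_μ` takes the value `α`. -/
noncomputable def Points.ofTotal {α : c.f.rootSet K} (y : Spec (.of F) ⟶ c.Y)
    (h : y ≫ c.toConst = Spec.map (CommRingCat.ofHom ((algebraMap K F).comp (c.evalAt α)))) :
    c.Points α F :=
  ⟨pullback.lift y (Spec.map (CommRingCat.ofHom (algebraMap K F)))
    (by rw [h, ← Spec.map_comp, ← CommRingCat.ofHom_comp]), pullback.lift_snd _ _ _⟩

@[simp]
lemma Points.total_ofTotal {α : c.f.rootSet K} (y : Spec (.of F) ⟶ c.Y)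
    (h : y ≫ c.toConst = Spec.map (CommRingCat.ofHom ((algebraMap K F).comp (c.evalAt α)))) :
    (Points.ofTotal y h).total = y :=
  pullback.lift_fst _ _ _

lemma Points.ext_total {α : c.f.rootSet K} {y z : c.Points α F} (h : y.total = z.total) :
    y = z :=
  Subtype.ext (c.variety_hom_ext h (y.2.trans z.2.symm))

lemma toConst_comp : c.toConst ≫ Spec.map (CommRingCat.ofHom (AdjoinRoot.of c.f)) = c.π ≫ s :=
  toConstants_comp _ _ _ _

variable [Algebra k F] [IsScalarTower k K F]

lemma algebraMap_comp_evalAt_of (α : c.f.rootSet K) :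
    ((algebraMap K F).comp (c.evalAt α)).comp (AdjoinRoot.of c.f) = algebraMap k F := by
  ext x
  simp [evalAt, AdjoinRoot.lift_of (c.eval_root α), ← IsScalarTower.algebraMap_apply]

lemma Points.total_over {α : c.f.rootSet K} (y : c.Points α F) :
    y.total ≫ c.π ≫ s = Spec.map (CommRingCat.ofHom (algebraMap k F)) := by
  rw [← toConst_comp, ← Category.assoc, y.total_toConst, ← Spec.map_comp,
    ← CommRingCat.ofHom_comp, algebraMap_comp_evalAt_of]

/-- Every point of `Y_μ` over `k` lies on some `X_{μ,α}`. -/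
lemma exists_root_of_point [IsAlgClosure k K] (y : Spec (.of F) ⟶ c.Y)
    (h : y ≫ c.π ≫ s = Spec.map (CommRingCat.ofHom (algebraMap k F))) :
    ∃ α : c.f.rootSet K, y ≫ c.toConst =
      Spec.map (CommRingCat.ofHom ((algebraMap K F).comp (c.evalAt α))) := by
  obtain ⟨ψ, hψ⟩ := Spec.map_surjective (y ≫ c.toConst)
  have hk : ψ.hom.comp (AdjoinRoot.of c.f) = algebraMap k F := by
    rw [← toConst_comp, ← Category.assoc, ← hψ, ← Spec.map_comp] at h
    exact congrArg CommRingCat.Hom.hom (Spec.map_injective h)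
  have hroot : Polynomial.eval₂ (algebraMap k F) (ψ.hom (AdjoinRoot.root c.f)) c.f = 0 := by
    rw [← hk, ← Polynomial.hom_eval₂, AdjoinRoot.eval₂_root, map_zero]
  obtain ⟨α, hα⟩ := DistinguishedSystem.exists_root_lift (K := K) (f := c.f)
    (⟨ψ.hom (AdjoinRoot.root c.f),
      Polynomial.mem_rootSet.mpr ⟨c.monic.ne_zero, hroot⟩⟩ : c.f.rootSet F)
  refine ⟨α, hψ.symm.trans ?_⟩
  congr 1
  ext1
  refine AdjoinRoot.ringHom_ext ?_ ?_
  · rw [hk]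
    exact (algebraMap_comp_evalAt_of α).symm
  · rw [CommRingCat.hom_ofHom, RingHom.comp_apply, evalAt, AdjoinRoot.lift_root (c.eval_root α), hα]

/-- Coordinates determine the image in `P^N` over `k`, and fixing `α` determines the image in `Spec`
of the field of constants. Together these give the image under the immersion into `P^N` over that
field, which is a monomorphism. -/
lemma coords_injective {α : c.f.rootSet K} :
    Function.Injective (c.coords : c.Points α F → Projectivization F (Fin (N + 1) → F)) := by
  intro y z h
  have hover (y : c.Points α F) : (y.total ≫ c.emb) ≫ projSpaceToSpec k N =
      Spec.map (CommRingCat.ofHom (algebraMap k F)) := by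
    rw [Category.assoc, c.emb_over, y.total_over]
  have hcoords (y : c.Points α F) : c.coords y = homogeneousCoords (y.total ≫ c.emb) := by
    rw [coords, Points.total, Category.assoc]
  rw [hcoords, hcoords] at h
  have hemb := homogeneousCoords_injective (hover y) (hover z) h
  apply Points.ext_total
  have := c.isImmersion_emb
  rw [← cancel_mono (pullback.lift c.emb (toConstants (c.π ≫ s) c.f c.a c.eval_a)
    (c.emb_over.trans (toConstants_comp (c.π ≫ s) c.f c.a c.eval_a).symm))]
  apply pullback.hom_ext
  · rwa [Category.assoc, Category.assoc, pullback.lift_fst]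
  · rw [Category.assoc, Category.assoc, pullback.lift_snd]
    exact y.total_toConst.trans z.total_toConst.symm

end CoverPresentation

/-! ### Connected components of finite étale schemes, and domination of Galois covers. -/

section FiniteEtale

/-- The map is open and closed with finite fibres over a connected base, so there are finitely many
components. -/
lemma isOpen_connectedComponent_of_finite_etale {P X : Scheme.{u}} (ρ : P ⟶ X) [IsFinite ρ]
    [Etale ρ] [ConnectedSpace X] (x : P) : IsOpen (connectedComponent x) := by
  have : Finite (_root_.ConnectedComponents P) :=
    IsOpenMap.finite_connectedComponents_of_finite_preimage_singleton_of_connectedSpace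
      ρ.isOpenMap ρ.isClosedMap (ρ.finite_preimage_singleton (ρ x))
  rw [← connectedComponents_preimage_singleton]
  exact (isOpen_discrete _).preimage ConnectedComponents.continuous_coe

lemma surjective_of_finite_etale {P X : Scheme.{u}} (ρ : P ⟶ X) [IsFinite ρ] [Etale ρ]
    [Nonempty P] [ConnectedSpace X] : Surjective ρ := by
  refine ⟨Set.range_eq_univ.mp ?_⟩
  exact IsClopen.eq_univ ⟨ρ.isClosedMap.isClosed_range, ρ.isOpenMap.isOpen_range⟩
    (Set.range_nonempty _)

/-- An endomorphism sending a point of an open connected component into it restricts to this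
component. -/
lemma exists_restrict_connectedComponent {P : Scheme.{u}} (p : P) (U : P.Opens)
    (hU : (U : Set P) = connectedComponent p) (f : P ⟶ P) (a : P) (ha : a ∈ U) (hfa : f a ∈ U) :
    ∃ g : U.toScheme ⟶ U.toScheme, g ≫ U.ι = U.ι ≫ f := by
  have hsub : f '' U ⊆ U := by
    have h1 : connectedComponent (f a) = U := by
      rw [hU]
      exact (connectedComponent_eq (hU ▸ hfa : f a ∈ connectedComponent p)).symm
    have h2 : _root_.IsPreconnected (U : Set P) := by
      rw [hU]
      exact isPreconnected_connectedComponent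
    conv_rhs => rw [← h1]
    refine _root_.IsPreconnected.subset_connectedComponent ?_ ⟨a, ha, rfl⟩
    exact h2.image _ f.continuous.continuousOn
  refine ⟨IsOpenImmersion.lift U.ι (U.ι ≫ f) ?_, IsOpenImmersion.lift_fac _ _ _⟩
  rintro _ ⟨x, rfl⟩
  rw [Scheme.Opens.range_ι, Scheme.Hom.comp_apply]
  exact hsub ⟨_, x.2, rfl⟩

/-- Two Galois covers are dominated by a third one. -/
lemma exists_galoisCover_dominating {X Y₁ Y₂ : Scheme.{u}} [ConnectedSpace X] {π₁ : Y₁ ⟶ X}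
    {π₂ : Y₂ ⟶ X} (h₁ : IsGaloisCover π₁) (h₂ : IsGaloisCover π₂) {F : Type u} [Field F]
    (y₁ : Spec (.of F) ⟶ Y₁) (y₂ : Spec (.of F) ⟶ Y₂) (h : y₁ ≫ π₁ = y₂ ≫ π₂) :
    ∃ (Z : Scheme.{u}) (π : Z ⟶ X) (q₁ : Z ⟶ Y₁) (q₂ : Z ⟶ Y₂) (z : Spec (.of F) ⟶ Z),
      IsGaloisCover π ∧ q₁ ≫ π₁ = π ∧ q₂ ≫ π₂ = π ∧ z ≫ q₁ = y₁ ∧ z ≫ q₂ = y₂ := by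
  have := h₁.isFinite
  have := h₁.etale
  have := h₂.isFinite
  have := h₂.etale
  let P := pullback π₁ π₂
  let ρ : P ⟶ X := pullback.fst π₁ π₂ ≫ π₁
  let z₀ : Spec (.of F) ⟶ P := pullback.lift y₁ y₂ h
  let p : P := z₀ (IsLocalRing.closedPoint F)
  -- The dominating cover is the component through `(y₁, y₂)` of the fibre product.
  let U : P.Opens := ⟨connectedComponent p, isOpen_connectedComponent_of_finite_etale ρ p⟩
  have hcl : IsClosedImmersion U.ι := by
    refine IsClosedImmersion.of_isPreimmersion _ ?_
    rw [Scheme.Opens.range_ι]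
    exact isClosed_connectedComponent
  have hz₀ : Set.range z₀ ⊆ Set.range U.ι := by
    rw [Scheme.Opens.range_ι]
    rintro _ ⟨w, rfl⟩
    obtain rfl : w = IsLocalRing.closedPoint F := Subsingleton.elim _ _
    exact mem_connectedComponent
  refine ⟨U, U.ι ≫ ρ, U.ι ≫ pullback.fst π₁ π₂, U.ι ≫ pullback.snd π₁ π₂,
    IsOpenImmersion.lift U.ι z₀ hz₀, ⟨inferInstance, inferInstance, ?_, ?_⟩, ?_, ?_, ?_, ?_⟩
  · exact isConnected_iff_connectedSpace.mp isConnected_connectedComponent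
  · intro Ω _ _ y y' hy
    have hcond : pullback.fst π₁ π₂ ≫ π₁ = pullback.snd π₁ π₂ ≫ π₂ := pullback.condition
    obtain ⟨g₁, hg₁, e₁⟩ := h₁.transitive Ω (y ≫ U.ι ≫ pullback.fst π₁ π₂)
      (y' ≫ U.ι ≫ pullback.fst π₁ π₂) (by simpa [ρ] using hy)
    obtain ⟨g₂, hg₂, e₂⟩ := h₂.transitive Ω (y ≫ U.ι ≫ pullback.snd π₁ π₂)
      (y' ≫ U.ι ≫ pullback.snd π₁ π₂) (by simpa [ρ, hcond] using hy)
    -- Transitivity on both factors gives an automorphism of the fibre product taking `y` to `y'`.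
    -- Both lie on the component `U`, so `G` and its inverse map `U` into itself.
    let G : P ≅ P := asIso (pullback.map π₁ π₂ π₁ π₂ g₁.hom g₂.hom (𝟙 X) (by simp [hg₁])
      (by simp [hg₂]))
    have hG₁ : G.hom ≫ pullback.fst π₁ π₂ = pullback.fst π₁ π₂ ≫ g₁.hom := pullback.lift_fst _ _ _
    have hG₂ : G.hom ≫ pullback.snd π₁ π₂ = pullback.snd π₁ π₂ ≫ g₂.hom := pullback.lift_snd _ _ _
    have hGy : (y ≫ U.ι) ≫ G.hom = y' ≫ U.ι := by
      apply pullback.hom_ext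
      · simpa [hG₁] using e₁
      · simpa [hG₂] using e₂
    let w : Spec (.of Ω) := IsLocalRing.closedPoint Ω
    have hGw : G.hom (U.ι (y w)) = U.ι (y' w) := by
      rw [← Scheme.Hom.comp_apply, ← Scheme.Hom.comp_apply, ← Category.assoc, hGy,
        Scheme.Hom.comp_apply]
    have hGw' : G.inv (U.ι (y' w)) = U.ι (y w) := by
      rw [← hGw, ← Scheme.Hom.comp_apply, G.hom_inv_id]
      rfl
    obtain ⟨g, hg⟩ := exists_restrict_connectedComponent p U rfl G.hom (U.ι (y w)) (y w).2
      (by rw [hGw]; exact (y' w).2)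
    obtain ⟨g', hg'⟩ := exists_restrict_connectedComponent p U rfl G.inv (U.ι (y' w)) (y' w).2
      (by rw [hGw']; exact (y w).2)
    refine ⟨⟨g, g', ?_, ?_⟩, ?_, ?_⟩
    · rw [← cancel_mono U.ι, Category.assoc, hg', reassoc_of% hg, G.hom_inv_id]
      simp
    · rw [← cancel_mono U.ι, Category.assoc, hg, reassoc_of% hg', G.inv_hom_id]
      simp
    · change g ≫ U.ι ≫ ρ = U.ι ≫ ρ
      rw [reassoc_of% hg, reassoc_of% hG₁, hg₁]
    · rw [← cancel_mono U.ι, Category.assoc, hg, ← Category.assoc, hGy]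
  · simp [ρ]
  · simp only [ρ, Category.assoc, pullback.condition]
  · rw [IsOpenImmersion.lift_fac_assoc]
    exact pullback.lift_fst _ _ _
  · rw [IsOpenImmersion.lift_fac_assoc]
    exact pullback.lift_snd _ _ _

end FiniteEtale

/-! ### Points over algebraically closed fields. -/

section GeometricPoints

/-- Nullstellensatz: quasi-compactness provides a closed point, and closed points are rational over
`F`. -/
lemma exists_section_of_locallyOfFiniteType {F : Type u} [Field F] [IsAlgClosed F] {W : Scheme.{u}}
    [Nonempty W] [CompactSpace W] (t : W ⟶ Spec (.of F)) [LocallyOfFiniteType t] :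
    ∃ w : Spec (.of F) ⟶ W, w ≫ t = 𝟙 _ := by
  obtain ⟨x, -, hx⟩ := IsClosed.exists_closed_singleton (X := W) isClosed_univ Set.univ_nonempty
  exact ⟨pointOfClosedPoint t x hx, pointOfClosedPoint_comp t x hx⟩

/-- A point with values in an algebraically closed field lifts along a finite surjective
morphism. -/
lemma exists_lift_of_finite_surjective {F : Type u} [Field F] [IsAlgClosed F] {Y X : Scheme.{u}}
    (ρ : Y ⟶ X) [IsFinite ρ] [Surjective ρ] (x : Spec (.of F) ⟶ X) :
    ∃ y : Spec (.of F) ⟶ Y, y ≫ ρ = x := by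
  have : Nonempty ↥(pullback ρ x) :=
    ⟨((pullback.snd ρ x).surjective (IsLocalRing.closedPoint F)).choose⟩
  have : CompactSpace ↥(pullback ρ x) :=
    QuasiCompact.compactSpace_of_compactSpace (pullback.snd ρ x)
  obtain ⟨w, hw⟩ := exists_section_of_locallyOfFiniteType (pullback.snd ρ x)
  exact ⟨w ≫ pullback.fst ρ x, by
    rw [Category.assoc, pullback.condition, reassoc_of% hw]⟩

/-- Finite morphisms have finitely many points over a given geometric point. -/
lemma finite_lifts {F : Type u} [Field F] [IsAlgClosed F] {Y X : Scheme.{u}}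
    (ρ : Y ⟶ X) [IsFinite ρ] (x : Spec (.of F) ⟶ X) :
    Finite {y : Spec (.of F) ⟶ Y // y ≫ ρ = x} := by
  have hW : Finite ↥(pullback ρ x) := by
    have h := (pullback.snd ρ x).finite_preimage_singleton (IsLocalRing.closedPoint F)
    refine Set.finite_univ_iff.mp (h.subset fun w _ => ?_)
    exact Subsingleton.elim (α := PrimeSpectrum F) _ _
  have : Finite (closedPoints ↥(pullback ρ x)) := inferInstance
  have := Finite.of_equiv _ (pointEquivClosedPoint (pullback.snd ρ x)).symm
  refine Finite.of_injective (fun y : {y : Spec (.of F) ⟶ Y // y ≫ ρ = x} =>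
    (⟨pullback.lift y.1 (𝟙 _) (by rw [y.2, Category.id_comp]), pullback.lift_snd _ _ _⟩ :
      {p : Spec (.of F) ⟶ pullback ρ x // p ≫ pullback.snd ρ x = 𝟙 _})) fun y z h => ?_
  have h' := congrArg (fun p => p.1 ≫ pullback.fst ρ x) h
  simp only [pullback.lift_fst] at h'
  exact Subtype.ext h'

lemma exists_geometric_point {k F : Type u} [Field k] [Field F] [Algebra k F] [IsAlgClosed F]
    {X : Scheme.{u}} [CompactSpace X] [Nonempty X] (s : X ⟶ Spec (.of k)) [LocallyOfFiniteType s] :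
    ∃ x : Spec (.of F) ⟶ X, x ≫ s = Spec.map (CommRingCat.ofHom (algebraMap k F)) := by
  let t := Spec.map (CommRingCat.ofHom (algebraMap k F))
  have : Subsingleton (Spec (.of k)) := inferInstanceAs (Subsingleton (PrimeSpectrum k))
  have : Nonempty (Spec (.of F)) := inferInstanceAs (Nonempty (PrimeSpectrum F))
  have : CompactSpace ↥(pullback s t) :=
    QuasiCompact.compactSpace_of_compactSpace (pullback.fst s t)
  obtain ⟨w, hw⟩ := exists_section_of_locallyOfFiniteType (pullback.snd s t)
  exact ⟨w ≫ pullback.fst s t, by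
    rw [Category.assoc, pullback.condition, reassoc_of% hw]⟩

end GeometricPoints

/-! ### Morphisms to the spectrum of a field. -/

section Constants

variable {k : Type u} [Field k]

lemma toSpecΓ_constMap {Y : Scheme.{u}} (t : Y ⟶ Spec (.of k)) :
    Y.toSpecΓ ≫ Spec.map (CommRingCat.ofHom (constMap t)) = t := by
  rw [constMap, CommRingCat.ofHom_hom, Spec.map_comp, ← Scheme.toSpecΓ_naturality_assoc]
  simp

lemma ext_constMap {Y : Scheme.{u}} {t t' : Y ⟶ Spec (.of k)} (h : constMap t = constMap t') :
    t = t' := by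
  rw [← toSpecΓ_constMap t, h, toSpecΓ_constMap]

lemma constMap_comp {Y Z : Scheme.{u}} (q : Z ⟶ Y) (t : Y ⟶ Spec (.of k)) :
    constMap (q ≫ t) = q.appTop.hom.comp (constMap t) := by
  rw [constMap, constMap, Scheme.Hom.comp_appTop, ← Category.assoc]
  rfl

lemma constMap_comp_specMap {L : Type u} [Field L] {Y : Scheme.{u}} (t : Y ⟶ Spec (.of L))
    (φ : k →+* L) :
    constMap (t ≫ Spec.map (CommRingCat.ofHom φ)) = (constMap t).comp φ := by
  rw [constMap, constMap, Scheme.Hom.comp_appTop, ← Category.assoc,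
    ← Scheme.ΓSpecIso_inv_naturality]
  rfl

end Constants

/-! ### Functoriality of constants, and fibres over a geometric point. -/

namespace CoverPresentation

variable {k : Type u} [Field k] {X : Scheme.{u}} {s : X ⟶ Spec (.of k)} {N : ℕ}

/-- A morphism of covers maps the field of constants of the target into that of the source. -/
lemma exists_constants_hom (c d : CoverPresentation s N) (q : d.Y ⟶ c.Y) (hq : q ≫ c.π = d.π) :
    ∃ θ : AdjoinRoot c.f →+* AdjoinRoot d.f,
      q ≫ c.toConst = d.toConst ≫ Spec.map (CommRingCat.ofHom θ) := by
  have hcomp : q.appTop.hom.comp (constMap (c.π ≫ s)) = constMap (d.π ≫ s) := by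
    rw [← constMap_comp, reassoc_of% hq]
  obtain ⟨g, hg⟩ := d.generates (q.appTop.hom c.a) ⟨c.f, c.monic, by
    rw [← hcomp, ← Polynomial.hom_eval₂, c.eval_a, map_zero]⟩
  have hd : (AdjoinRoot.lift (constMap (d.π ≫ s)) d.a d.eval_a).comp (AdjoinRoot.of d.f) =
      constMap (d.π ≫ s) := RingHom.ext fun x => AdjoinRoot.lift_of d.eval_a
  have hroot : c.f.eval₂ (AdjoinRoot.of d.f) (AdjoinRoot.mk d.f g) = 0 := by
    -- A field embeds into any nonzero ring, so the root equation may be checked among global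
    -- functions of `d.Y`.
    apply (AdjoinRoot.lift (constMap (d.π ≫ s)) d.a d.eval_a).injective
    rw [Polynomial.hom_eval₂, hd, AdjoinRoot.lift_mk, hg, map_zero, ← hcomp,
      ← Polynomial.hom_eval₂, c.eval_a, map_zero]
  refine ⟨AdjoinRoot.lift (AdjoinRoot.of d.f) _ hroot, ext_constMap ?_⟩
  rw [constMap_comp, constMap_comp_specMap, constMap_toConst, constMap_toConst]
  refine AdjoinRoot.ringHom_ext (RingHom.ext fun x => ?_) ?_
  · simp only [RingHom.comp_apply, AdjoinRoot.lift_of c.eval_a, AdjoinRoot.lift_of hroot,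
      AdjoinRoot.lift_of d.eval_a]
    exact RingHom.congr_fun hcomp x
  · simp only [RingHom.comp_apply, AdjoinRoot.lift_root c.eval_a, AdjoinRoot.lift_root hroot,
      AdjoinRoot.lift_mk, hg]

lemma etale_specMap_adjoinRoot [CharZero k] (c : CoverPresentation s N) :
    Etale (Spec.map (CommRingCat.ofHom (AdjoinRoot.of c.f))) := by
  have := c.monic.finite_adjoinRoot
  have : Algebra.FormallyEtale k (AdjoinRoot c.f) := Algebra.FormallyEtale.of_isSeparable k _
  have : Algebra.Etale k (AdjoinRoot c.f) :=
    ⟨inferInstance, Algebra.FinitePresentation.of_finiteType.mp inferInstance⟩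
  rw [HasRingHomProperty.Spec_iff (P := @Etale)]
  exact RingHom.etale_algebraMap.mpr this

variable {K : Type u} [Field K] [Algebra k K] {F : Type u} [Field F] [Algebra K F]

/-- The points of `X_{μ,α}` over a given geometric point of `X`. -/
def FiberPoints (c : CoverPresentation s N) (α : c.f.rootSet K) (x : Spec (.of F) ⟶ X) : Type u :=
  {y : c.Points α F // y.total ≫ c.π = x}

lemma finite_fiberPoints [IsAlgClosed F] (c : CoverPresentation s N) (α : c.f.rootSet K)
    (x : Spec (.of F) ⟶ X) : Finite (c.FiberPoints α x) := by
  have := finite_lifts c.π x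
  exact Finite.of_injective (fun y : c.FiberPoints α x =>
    (⟨y.1.total, y.2⟩ : {y : Spec (.of F) ⟶ c.Y // y ≫ c.π = x})) fun y z h =>
      Subtype.ext (Points.ext_total (congrArg Subtype.val h))

variable [Algebra k F] [IsScalarTower k K F]

/-- Geometric connectedness keeps `X` connected after base change to the field of constants. The
induced map from `Y` to this base change is finite étale by cancellation, hence surjective, and the
point given by `x` and `α` lifts. -/
lemma nonempty_fiberPoints [CharZero k] [IsAlgClosed F] [GeometricallyConnected s]
    (c : CoverPresentation s N) (α : c.f.rootSet K) (x : Spec (.of F) ⟶ X)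
    (hx : x ≫ s = Spec.map (CommRingCat.ofHom (algebraMap k F))) :
    Nonempty (c.FiberPoints α x) := by
  let i := Spec.map (CommRingCat.ofHom (AdjoinRoot.of c.f))
  have := c.etale_specMap_adjoinRoot
  have : ConnectedSpace ↥(pullback s i) :=
    GeometricallyConnected.geometrically_connectedSpace (f := s) _ _ _ (.of_hasPullback _ _)
  let ψ : c.Y ⟶ pullback s i := pullback.lift c.π c.toConst c.toConst_comp.symm
  have hψ : ψ ≫ pullback.fst s i = c.π := pullback.lift_fst _ _ _
  have : IsFinite (ψ ≫ pullback.fst s i) := by rw [hψ]; infer_instance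
  have : Etale (ψ ≫ pullback.fst s i) := by rw [hψ]; infer_instance
  have : IsFinite ψ := IsFinite.of_comp ψ (pullback.fst s i)
  have : Etale ψ := Etale.of_comp ψ (pullback.fst s i)
  have := surjective_of_finite_etale ψ
  obtain ⟨y, hy⟩ := exists_lift_of_finite_surjective ψ (pullback.lift x
    (Spec.map (CommRingCat.ofHom ((algebraMap K F).comp (c.evalAt α))))
    (by rw [hx, ← Spec.map_comp, ← CommRingCat.ofHom_comp, algebraMap_comp_evalAt_of]))
  refine ⟨⟨Points.ofTotal y ?_, ?_⟩⟩
  · have := congrArg (· ≫ pullback.snd s i) hy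
    simpa only [ψ, Category.assoc, pullback.lift_snd] using this
  · have := congrArg (· ≫ pullback.fst s i) hy
    simpa only [ψ, Category.assoc, pullback.lift_fst, Points.total_ofTotal] using this

end CoverPresentation

/-! ### Intermediate morphisms and directedness. -/

namespace IntermediateMorphism

variable {k : Type u} [Field k] {X : Scheme.{u}} {s : X ⟶ Spec (.of k)} {N : ℕ} {M : Type v}
  {C : M → CoverPresentation s N} {K : Type u} [Field K] [Algebra k K]
  {F : Type u} [Field F] [Algebra K F]

/-- A morphism of covers which maps a point of `X_{μ,α}` to a point of `X_{ν,β}` induces an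
intermediate morphism. -/
lemma nonempty_of_hom {i j : Index C K} (q : (C i.1).Y ⟶ (C j.1).Y)
    (hq : q ≫ (C j.1).π = (C i.1).π) (z : (C i.1).Points i.2 F) (y : (C j.1).Points j.2 F)
    (h : z.total ≫ q = y.total) : Nonempty (IntermediateMorphism i j) := by
  obtain ⟨θ, hθ⟩ := CoverPresentation.exists_constants_hom _ _ q hq
  -- The single pair of points `z`, `y` already forces compatibility with the two chosen roots,
  -- since `K` embeds in `F`.
  have h1 : ((C i.1).evalAt i.2).comp θ = (C j.1).evalAt j.2 := by
    have h2 := y.total_toConst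
    rw [← h, Category.assoc, hθ, ← Category.assoc, z.total_toConst, ← Spec.map_comp,
      ← CommRingCat.ofHom_comp, RingHom.comp_assoc] at h2
    have h3 := congrArg CommRingCat.Hom.hom (Spec.map_injective h2)
    exact RingHom.ext fun x => (algebraMap K F).injective (RingHom.congr_fun h3 x)
  refine ⟨⟨pullback.lift ((C i.1).toTotal i.2 ≫ q) ((C i.1).structMap i.2) ?_,
    pullback.lift_snd _ _ _, ?_⟩⟩
  · have hc : (C i.1).toTotal i.2 ≫ (C i.1).toConst = (C i.1).structMap i.2 ≫ _ :=
      pullback.condition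
    rw [Category.assoc, hθ, reassoc_of% hc, ← Spec.map_comp, ← CommRingCat.ofHom_comp, h1]
  · exact (pullback.lift_fst_assoc _ _ _ _).trans (by
      rw [Category.assoc, hq, CoverPresentation.covering])

/-- The action of an intermediate morphism on points. -/
noncomputable def mapPoint {i j : Index C K} (p : IntermediateMorphism i j) (y : (C i.1).Points i.2 F) :
    (C j.1).Points j.2 F :=
  ⟨y.1 ≫ p.hom, by rw [Category.assoc, p.hom_struct, y.2]⟩

lemma mapPoint_total_π {i j : Index C K} (p : IntermediateMorphism i j)
    (y : (C i.1).Points i.2 F) : (p.mapPoint y).total ≫ (C j.1).π = y.total ≫ (C i.1).π := by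
  have := p.hom_covering
  simp only [CoverPresentation.covering] at this
  simp only [CoverPresentation.Points.total, mapPoint, Category.assoc, this]

variable [Algebra k F] [IsScalarTower k K F] [IsAlgClosure k K] [IsAlgClosed F] [CharZero k]
  [GeometricallyConnected s] [ConnectedSpace X]

/-- The system of all `X_{μ,α}` is directed. -/
lemma exists_dominating (hC : RepresentsAllCovers C) (x : Spec (.of F) ⟶ X)
    (hx : x ≫ s = Spec.map (CommRingCat.ofHom (algebraMap k F))) (i j : Index C K) :
    ∃ l : Index C K, Nonempty (IntermediateMorphism l i) ∧
      Nonempty (IntermediateMorphism l j) := by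
  obtain ⟨y₁, h₁⟩ := (C i.1).nonempty_fiberPoints i.2 x hx
  obtain ⟨y₂, h₂⟩ := (C j.1).nonempty_fiberPoints j.2 x hx
  obtain ⟨Z, π, q₁, q₂, z, hπ, hq₁, hq₂, hz₁, hz₂⟩ := exists_galoisCover_dominating
    (C i.1).isGaloisCover (C j.1).isGaloisCover y₁.total y₂.total (h₁.trans h₂.symm)
  obtain ⟨l, e, he⟩ := hC Z π hπ
  have he' : e.inv ≫ π = (C l).π := by rw [← he, e.inv_hom_id_assoc]
  -- The root `γ` indexing the dominating variety is the value of the generator of its constants at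
  -- the image of `z`.
  obtain ⟨γ, hγ⟩ := CoverPresentation.exists_root_of_point (K := K) (z ≫ e.hom) (by
    rw [Category.assoc, reassoc_of% he, ← hq₁, Category.assoc, reassoc_of% hz₁, y₁.total_over])
  refine ⟨⟨l, γ⟩, nonempty_of_hom (i := ⟨l, γ⟩) (e.inv ≫ q₁) (by simp [hq₁, he'])
    (.ofTotal _ hγ) y₁ (by simp [hz₁]), nonempty_of_hom (i := ⟨l, γ⟩) (e.inv ≫ q₂)
    (by simp [hq₂, he']) (.ofTotal _ hγ) y₂ (by simp [hz₂])⟩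

end IntermediateMorphism

/-! ### Nonemptiness of the limit. -/

namespace DistinguishedSystem

variable {k : Type u} [Field k] {X : Scheme.{u}} {s : X ⟶ Spec (.of k)} {N : ℕ} {M : Type v}
  {C : M → CoverPresentation s N} {K : Type u} [Field K] [Algebra k K]
  (D : DistinguishedSystem C K) {F : Type u} [Field F] [Algebra K F] [Algebra k F]
  [IsScalarTower k K F] [IsAlgClosure k K] [IsAlgClosed F] [CharZero k]
  [GeometricallyConnected s] [ConnectedSpace X]

/-- Over one geometric point of `X` the fibres are finite and nonempty, and the distinguished
morphisms make them a functor on a codirected order. Such a system has a compatible family. -/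
lemma nonempty_cover (hC : RepresentsAllCovers C) (x : Spec (.of F) ⟶ X)
    (hx : x ≫ s = Spec.map (CommRingCat.ofHom (algebraMap k F))) : Nonempty (D.Cover F) := by
  let P : Preorder (Index C K) :=
    { le i j := Nonempty (IntermediateMorphism i j)
      le_refl i := ⟨.id i⟩
      le_trans i j l := fun ⟨p⟩ ⟨q⟩ => ⟨p.comp q⟩ }
  have : IsCodirectedOrder (Index C K) := ⟨IntermediateMorphism.exists_dominating hC x hx⟩
  let Φ : Index C K ⥤ Type u :=
    { obj i := (C i.1).FiberPoints i.2 x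
      map {i j} h := ↾fun y => ⟨(D.dist h.le).mapPoint y.1,
        ((D.dist h.le).mapPoint_total_π y.1).trans y.2⟩
      map_id i := by
        ext y
        apply Subtype.ext
        apply Subtype.ext
        change y.1.1 ≫ (D.dist _).hom = y.1.1
        rw [D.dist_self]
        exact Category.comp_id _
      map_comp {i j l} h h' := by
        ext y
        apply Subtype.ext
        apply Subtype.ext
        change y.1.1 ≫ (D.dist _).hom = (y.1.1 ≫ (D.dist _).hom) ≫ (D.dist _).hom
        rw [← D.dist_comp h.le h'.le, Category.assoc]
        rfl }
  have hfin (i : Index C K) : Finite (Φ.obj i) := (C i.1).finite_fiberPoints i.2 x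
  have hne (i : Index C K) : Nonempty (Φ.obj i) := (C i.1).nonempty_fiberPoints i.2 x hx
  obtain ⟨u, hu⟩ := nonempty_sections_of_finite_cofiltered_system Φ
  exact ⟨⟨fun i => (u i).1, fun i j h => congrArg (fun y => y.1.1) (hu (homOfLE h))⟩⟩

end DistinguishedSystem

/-- Two lifts along an étale separated morphism of a morphism from a connected scheme are equal if
they agree at one point. -/
lemma eq_of_etale_of_point {T Y X Z : Scheme.{u}} (π : Y ⟶ X) [Etale π] [IsSeparated π]
    [ConnectedSpace T] (f g : T ⟶ Y) (h : f ≫ π = g ≫ π) [Nonempty Z] (z : Z ⟶ T)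
    (hz : z ≫ f = z ≫ g) : f = g := by
  let l : T ⟶ pullback π π := pullback.lift f g h
  -- This is the equalizer of `f` and `g`. The diagonal is an open immersion as `π` is étale and
  -- closed as `π` is separated, so the equalizer is a nonempty clopen part of the connected `T`.
  let e := pullback.fst l (pullback.diagonal π)
  have hf : l ≫ pullback.fst π π = f := pullback.lift_fst _ _ _
  have hg : l ≫ pullback.snd π π = g := pullback.lift_snd _ _ _
  have hl : z ≫ l = (z ≫ f) ≫ pullback.diagonal π := by
    apply pullback.hom_ext
    · rw [Category.assoc, hf, Category.assoc, pullback.diagonal_fst, Category.comp_id]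
    · rw [Category.assoc, hg, Category.assoc, pullback.diagonal_snd, Category.comp_id, hz]
  have hne : Nonempty ↥(pullback l (pullback.diagonal π)) :=
    ⟨pullback.lift z (z ≫ f) hl (Classical.arbitrary Z)⟩
  have hsurj : Surjective e := by
    refine ⟨Set.range_eq_univ.mp ?_⟩
    exact IsClopen.eq_univ ⟨e.isClosedMap.isClosed_range, e.isOpenMap.isOpen_range⟩
      (Set.range_nonempty _)
  have : IsIso e := (isIso_iff_isOpenImmersion_and_epi_base e).mpr
    ⟨inferInstance, (TopCat.epi_iff_surjective _).mpr e.surjective⟩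
  have hcond : e ≫ l = pullback.snd l (pullback.diagonal π) ≫ pullback.diagonal π :=
    pullback.condition
  rw [← cancel_epi e, ← hf, ← hg, reassoc_of% hcond, reassoc_of% hcond]
  simp

/-! ### Conjugation of points and of intermediate morphisms. -/

namespace CoverPresentation

variable {k : Type u} [Field k] {X : Scheme.{u}} {s : X ⟶ Spec (.of k)} {N : ℕ}
  {c : CoverPresentation s N} {K : Type u} [Field K] [Algebra k K] {F : Type u} [Field F]
  [Algebra K F] [Algebra k F]

/-- The conjugate under `σ` of a point of `X_{μ,α}`, a point of `X_{μ,σ(α)}`. -/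
noncomputable def Points.conj (σ : F ≃ₐ[k] F) (τ : K ≃ₐ[k] K)
    (hτ : ∀ x, algebraMap K F (τ x) = σ (algebraMap K F x)) {α α' : c.f.rootSet K}
    (h : (α' : K) = τ α) (y : c.Points α F) : c.Points α' F :=
  ofTotal (Spec.map (CommRingCat.ofHom (σ : F →+* F)) ≫ y.total) (by
    have e := congrArg CommRingCat.Hom.hom (c.evalAt_conj τ h)
    rw [Category.assoc, y.total_toConst, ← Spec.map_comp, ← CommRingCat.ofHom_comp]
    refine congrArg (fun φ => Spec.map (CommRingCat.ofHom φ)) (RingHom.ext fun x => ?_)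
    simp only [RingHom.comp_apply]
    rw [show c.evalAt α' x = τ (c.evalAt α x) from (RingHom.congr_fun e x).symm, hτ]
    rfl)

variable (σ : F ≃ₐ[k] F) (τ : K ≃ₐ[k] K) (hτ : ∀ x, algebraMap K F (τ x) = σ (algebraMap K F x))
  {α α' : c.f.rootSet K} (h : (α' : K) = τ α)

lemma Points.conj_total (y : c.Points α F) :
    (y.conj σ τ hτ h).total = Spec.map (CommRingCat.ofHom (σ : F →+* F)) ≫ y.total :=
  total_ofTotal _ _

lemma Points.conj_twist (y : c.Points α F) :
    (y.conj σ τ hτ h).1 ≫ c.twist τ h = Spec.map (CommRingCat.ofHom (σ : F →+* F)) ≫ y.1 := by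
  apply c.variety_hom_ext
  · rw [Category.assoc, twist_toTotal, Category.assoc]
    exact y.conj_total σ τ hτ h
  · rw [Category.assoc, twist_structMap, ← Category.assoc, (y.conj σ τ hτ h).2, Category.assoc,
      y.2, ← Spec.map_comp, ← Spec.map_comp]
    congr 1
    ext x
    exact hτ x

lemma Points.coords_conj (y : c.Points α F) :
    c.coords (y.conj σ τ hτ h) = projAct N σ (c.coords y) := by
  have hcoords {α : c.f.rootSet K} (y : c.Points α F) :
      c.coords y = homogeneousCoords (y.total ≫ c.emb) := by
    rw [coords, Points.total, Category.assoc]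
  rw [hcoords, hcoords, y.conj_total σ τ hτ h, Category.assoc, homogeneousCoords_conj]

/-- The conjugates of a point depend only on the values of the automorphism at finitely many
elements. -/
lemma Points.exists_finset_conj [IsScalarTower k K F] (y : c.Points α F) :
    ∃ S : Finset F, ∀ (σ σ' : F ≃ₐ[k] F) (τ τ' : K ≃ₐ[k] K)
      (hτ : ∀ x, algebraMap K F (τ x) = σ (algebraMap K F x))
      (hτ' : ∀ x, algebraMap K F (τ' x) = σ' (algebraMap K F x))
      (α' : c.f.rootSet K) (h : (α' : K) = τ α) (h' : (α' : K) = τ' α),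
      (∀ x ∈ S, σ x = σ' x) → y.conj σ τ hτ h = y.conj σ' τ' hτ' h' := by
  classical
  -- The entries of one homogeneous coordinate vector suffice, since the coordinates of the
  -- conjugate determine it.
  refine ⟨Finset.univ.image (c.coords y).rep, fun σ σ' τ τ' hτ hτ' α' h h' hS => ?_⟩
  apply coords_injective
  rw [coords_conj, coords_conj, ← (c.coords y).mk_rep]
  have : coordMap N σ (c.coords y).rep = coordMap N σ' (c.coords y).rep :=
    funext fun j => hS _ (Finset.mem_image_of_mem _ (Finset.mem_univ j))
  simp only [projAct, Projectivization.map_mk, this]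

end CoverPresentation

namespace IntermediateMorphism

variable {k : Type u} [Field k] {X : Scheme.{u}} {s : X ⟶ Spec (.of k)} {N : ℕ} {M : Type v}
  {C : M → CoverPresentation s N} {K : Type u} [Field K] [Algebra k K]
  {F : Type u} [Field F] [Algebra K F]

/-- An intermediate morphism is determined by its value at one point. -/
lemma eq_of_mapPoint {i j : Index C K} [ConnectedSpace ↥(Var i)] (p q : IntermediateMorphism i j)
    (y : (C i.1).Points i.2 F) (h : p.mapPoint y = q.mapPoint y) : p = q := by
  have : Nonempty (Spec (.of F)) := inferInstanceAs (Nonempty (PrimeSpectrum F))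
  apply IntermediateMorphism.ext
  refine (C j.1).variety_hom_ext ?_ (p.hom_struct.trans q.hom_struct.symm)
  refine eq_of_etale_of_point (C j.1).π _ _ ?_ y.1 ?_
  · have := p.hom_covering.trans q.hom_covering.symm
    simpa only [CoverPresentation.covering, Category.assoc] using this
  · have := congrArg (fun y => y.total) h
    simpa only [CoverPresentation.Points.total, mapPoint, Category.assoc] using this

variable [Algebra k F] (σ : F ≃ₐ[k] F) (τ : K ≃ₐ[k] K)
  (hτ : ∀ x, algebraMap K F (τ x) = σ (algebraMap K F x))
  {μ ν : M} {α α' : (C μ).f.rootSet K} {β β' : (C ν).f.rootSet K}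
  (hα : (α' : K) = τ α) (hβ : (β' : K) = τ β)
  {p : IntermediateMorphism (C := C) (K := K) ⟨μ, α⟩ ⟨ν, β⟩}
  {q : IntermediateMorphism (C := C) (K := K) ⟨μ, α'⟩ ⟨ν, β'⟩}

lemma IsConj.mapPoint_conj (h : IsConj τ hα hβ p q) (y : (C μ).Points α F) :
    q.mapPoint (y.conj σ τ hτ hα) =
      CoverPresentation.Points.conj (c := C ν) σ τ hτ hβ (p.mapPoint y) := by
  apply CoverPresentation.Points.ext_total
  rw [CoverPresentation.Points.conj_total]
  have h1 : q.hom ≫ (C ν).toTotal β' = (C μ).twist τ hα ≫ p.hom ≫ (C ν).toTotal β := by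
    rw [← (C ν).twist_toTotal τ hβ, reassoc_of% h]
  have h2 := y.conj_twist σ τ hτ hα
  change ((y.conj σ τ hτ hα).1 ≫ q.hom) ≫ (C ν).toTotal β' =
    _ ≫ (y.1 ≫ p.hom) ≫ (C ν).toTotal β
  rw [Category.assoc, h1, ← Category.assoc, h2]
  simp only [Category.assoc]

/-- Conjugacy of intermediate morphisms can be checked at one point. -/
lemma isConj_of_mapPoint [ConnectedSpace ↥((C μ).variety α')] (y : (C μ).Points α F)
    (h : q.mapPoint (y.conj σ τ hτ hα) =
      CoverPresentation.Points.conj (c := C ν) σ τ hτ hβ (p.mapPoint y)) :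
    IsConj τ hα hβ p q := by
  -- The actual conjugate `q'` of `p` takes the same value as `q` at the conjugate of `y`, so
  -- rigidity identifies them.
  obtain ⟨q', hq'⟩ := exists_isConj τ hα hβ p
  have : ConnectedSpace ↥(Var (⟨μ, α'⟩ : Index C K)) := ‹ConnectedSpace ↥((C μ).variety α')›
  have e : q = q' := eq_of_mapPoint q q' (y.conj σ τ hτ hα) (by
    rw [h, hq'.mapPoint_conj σ τ hτ hα hβ])
  rw [e]
  exact hq'

end IntermediateMorphism

/-- An automorphism of a Galois extension which fixes the fixed field of a subgroup `H` agrees with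
elements of `H` on finite sets. -/
lemma exists_mem_eqOn_of_fixes_fixedField {k K : Type*} [Field k] [Field K] [Algebra k K]
    [IsGalois k K] (H : Subgroup (K ≃ₐ[k] K)) (τ : K ≃ₐ[k] K)
    (hτ : ∀ x ∈ IntermediateField.fixedField H, τ x = x) (S : Finset K) :
    ∃ ρ ∈ H, ∀ x ∈ S, ρ x = τ x := by
  let H' : ClosedSubgroup (K ≃ₐ[k] K) := ⟨H.topologicalClosure, H.isClosed_topologicalClosure⟩
  -- By infinite Galois theory the closure of `H` is the group fixing its fixed field; a
  -- neighbourhood of `τ` in the Krull topology prescribes values on `S`.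
  have hmem : τ ∈ H.topologicalClosure := by
    have h := InfiniteGalois.fixingSubgroup_fixedField H'
    change τ ∈ H'.1
    rw [← h]
    rintro ⟨x, hx⟩
    refine hτ x fun g => ?_
    exact hx ⟨g.1, H.le_topologicalClosure g.2⟩
  let E : IntermediateField k K := IntermediateField.adjoin k (S : Set K)
  have : FiniteDimensional k E :=
    IntermediateField.finiteDimensional_adjoin fun x _ => Algebra.IsIntegral.isIntegral x
  have hopen : IsOpen {ρ : K ≃ₐ[k] K | τ⁻¹ * ρ ∈ E.fixingSubgroup} :=
    (IntermediateField.fixingSubgroup_isOpen E).preimage (continuous_const_mul τ⁻¹)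
  have hmem' : τ ∈ closure (H : Set (K ≃ₐ[k] K)) := hmem
  obtain ⟨ρ, hρ, hρH⟩ := mem_closure_iff.mp hmem' _ hopen (by
    change τ⁻¹ * τ ∈ E.fixingSubgroup
    rw [inv_mul_cancel]
    exact one_mem _)
  refine ⟨ρ, hρH, fun x hx => ?_⟩
  have h : (τ⁻¹ * ρ) x = x := hρ ⟨x, IntermediateField.subset_adjoin k _ hx⟩
  calc ρ x = τ (τ.symm (ρ x)) := (τ.apply_symm_apply _).symm
    _ = τ x := congrArg τ h

/-! ### The group `G^♯` and the automorphisms of the structure. -/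

namespace DistinguishedSystem

variable {k : Type u} [Field k] {X : Scheme.{u}} {s : X ⟶ Spec (.of k)} {N : ℕ} {M : Type v}
  {C : M → CoverPresentation s N} {K : Type u} [Field K] [Algebra k K]
  (D : DistinguishedSystem C K)

lemma Cover.mapPoint_dist {F : Type u} [Field F] [Algebra K F] {D : DistinguishedSystem C K}
    (u : D.Cover F) {i j : Index C K}
    (h : Nonempty (IntermediateMorphism i j)) : (D.dist h).mapPoint (u.1 i) = u.1 j :=
  Subtype.ext (u.2 i j h)

/-- The group `G^♯` is closed. -/
lemma mem_gSharp_of_fixes_kSharp [IsGalois k K]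
    (hconn : ∀ i : Index C K, ConnectedSpace ↥(Var i)) (u : D.Cover K) (τ : K ≃ₐ[k] K)
    (hτ : ∀ x ∈ D.kSharp, τ x = x) : τ ∈ D.gSharp := by
  classical
  intro μ ν α α' β β' hα hβ h h'
  have hid (τ : K ≃ₐ[k] K) : ∀ x, algebraMap K K (τ x) = τ (algebraMap K K x) := fun _ => rfl
  obtain ⟨S₁, hS₁⟩ := (u.1 ⟨μ, α⟩).exists_finset_conj (k := k)
  obtain ⟨S₂, hS₂⟩ := (u.1 ⟨ν, β⟩).exists_finset_conj (k := k)
  -- `S₁` and `S₂` make `ρ` and `τ` conjugate the two points alike; including `α` and `β` ensures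
  -- that the conjugates lie on the same varieties.
  obtain ⟨ρ, hρ, hρS⟩ := exists_mem_eqOn_of_fixes_fixedField D.gSharp τ hτ
    (S₁ ∪ S₂ ∪ {(α : K), (β : K)})
  have hα' : (α' : K) = ρ α := by rw [hα, hρS _ (by simp)]
  have hβ' : (β' : K) = ρ β := by rw [hβ, hρS _ (by simp)]
  have := hconn ⟨μ, α'⟩
  refine IntermediateMorphism.isConj_of_mapPoint τ τ (hid τ) hα hβ (u.1 ⟨μ, α⟩) ?_
  have e := (hρ μ ν α α' β β' hα' hβ' h h').mapPoint_conj ρ ρ (hid ρ) hα' hβ' (u.1 ⟨μ, α⟩)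
  rw [u.mapPoint_dist h] at e ⊢
  rwa [hS₁ ρ τ ρ τ (hid ρ) (hid τ) α' hα' hα fun x hx => hρS x (by simp [hx]),
    hS₂ ρ τ ρ τ (hid ρ) (hid τ) β' hβ' hβ fun x hx => hρS x (by simp [hx])] at e

variable {F : Type u} [Field F] [Algebra K F] [Algebra k F]

lemma exists_root_apply (σ : K ≃ₐ[k] K) {f : Polynomial k} (α' : f.rootSet K) :
    ∃ α : f.rootSet K, (α' : K) = σ α := by
  obtain ⟨α, hα⟩ := exists_conj_root σ.symm α'
  exact ⟨α, by rw [hα, σ.apply_symm_apply]⟩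

/-- The action on the étale cover of an automorphism whose restriction to `K` is in `G^♯`. -/
noncomputable def conjCover (σ : F ≃ₐ[k] F) (τ : K ≃ₐ[k] K)
    (hτ : ∀ x, algebraMap K F (τ x) = σ (algebraMap K F x)) (hmem : τ ∈ D.gSharp)
    (u : D.Cover F) : D.Cover F :=
  ⟨fun i => CoverPresentation.Points.conj (c := C i.1) σ τ hτ (exists_root_apply τ i.2).choose_spec
      (u.1 ⟨i.1, (exists_root_apply τ i.2).choose⟩), by
    rintro ⟨μ, α'⟩ ⟨ν, β'⟩ h'
    -- Arbitrary preimages of the roots replace the chosen ones.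
    suffices ∀ (α : (C μ).f.rootSet K) (β : (C ν).f.rootSet K) (hα : (α' : K) = τ α)
        (hβ : (β' : K) = τ β), (CoverPresentation.Points.conj (c := C μ) σ τ hτ hα
          (u.1 ⟨μ, α⟩)).1 ≫ (D.dist h').hom =
            (CoverPresentation.Points.conj (c := C ν) σ τ hτ hβ (u.1 ⟨ν, β⟩)).1 from
      this _ _ _ _
    intro α β hα hβ
    have hα' : (α : K) = τ⁻¹ α' := by rw [hα]; exact (τ.symm_apply_apply _).symm
    have hβ' : (β : K) = τ⁻¹ β' := by rw [hβ]; exact (τ.symm_apply_apply _).symm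
    have h : Nonempty (IntermediateMorphism (C := C) (K := K) ⟨μ, α⟩ ⟨ν, β⟩) :=
      ⟨(IntermediateMorphism.exists_isConj τ⁻¹ hα' hβ' h'.some).choose⟩
    have e := (hmem μ ν α α' β β' hα hβ h h').mapPoint_conj σ τ hτ hα hβ (u.1 ⟨μ, α⟩)
    rw [u.mapPoint_dist h] at e
    exact congrArg Subtype.val e⟩

lemma conjCover_apply (σ : F ≃ₐ[k] F) (τ : K ≃ₐ[k] K)
    (hτ : ∀ x, algebraMap K F (τ x) = σ (algebraMap K F x)) (hmem : τ ∈ D.gSharp)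
    (u : D.Cover F) {μ : M} {α α' : (C μ).f.rootSet K} (h : (α' : K) = τ α) :
    (D.conjCover σ τ hτ hmem u).1 ⟨μ, α'⟩ =
      CoverPresentation.Points.conj (c := C μ) σ τ hτ h (u.1 ⟨μ, α⟩) := by
  have e : (exists_root_apply τ α').choose = α :=
    Subtype.ext (τ.injective ((exists_root_apply τ α').choose_spec.symm.trans h))
  subst e
  rfl

lemma conjCover_conjCover (σ σ' : F ≃ₐ[k] F) (τ τ' : K ≃ₐ[k] K)
    (hτ : ∀ x, algebraMap K F (τ x) = σ (algebraMap K F x)) (hmem : τ ∈ D.gSharp)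
    (hτ' : ∀ x, algebraMap K F (τ' x) = σ' (algebraMap K F x)) (hmem' : τ' ∈ D.gSharp)
    (hσ : ∀ x, σ' (σ x) = x) (u : D.Cover F) :
    D.conjCover σ' τ' hτ' hmem' (D.conjCover σ τ hτ hmem u) = u := by
  apply Subtype.ext
  funext ⟨μ, α⟩
  obtain ⟨α', hα'⟩ := exists_conj_root τ α
  have hα : (α : K) = τ' α' :=
    (algebraMap K F).injective (by rw [hτ', hα', hτ, hσ])
  rw [D.conjCover_apply σ' τ' hτ' hmem' _ hα, D.conjCover_apply σ τ hτ hmem u hα']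
  apply CoverPresentation.Points.ext_total
  rw [CoverPresentation.Points.conj_total, CoverPresentation.Points.conj_total, ← Category.assoc,
    ← Spec.map_comp, ← CommRingCat.ofHom_comp,
    show (σ' : F →+* F).comp (σ : F →+* F) = RingHom.id F from RingHom.ext hσ,
    CommRingCat.ofHom_id, Spec.map_id, Category.id_comp]

/-- `conjCover` as a permutation. -/
noncomputable def conjPerm (σ : F ≃ₐ[k] F) (τ : K ≃ₐ[k] K)
    (hτ : ∀ x, algebraMap K F (τ x) = σ (algebraMap K F x)) (hmem : τ ∈ D.gSharp) :
    Equiv.Perm (D.Cover F) :=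
  have hτ' : ∀ x, algebraMap K F (τ⁻¹ x) = σ⁻¹ (algebraMap K F x) := fun x => by
    apply σ.injective
    rw [← hτ]
    exact (congrArg (algebraMap K F) (τ.apply_symm_apply x)).trans (σ.apply_symm_apply _).symm
  { toFun := D.conjCover σ τ hτ hmem
    invFun := D.conjCover σ⁻¹ τ⁻¹ hτ' (inv_mem hmem)
    left_inv := D.conjCover_conjCover σ σ⁻¹ τ τ⁻¹ hτ hmem hτ' (inv_mem hmem) σ.symm_apply_apply
    right_inv := D.conjCover_conjCover σ⁻¹ σ τ⁻¹ τ hτ' (inv_mem hmem) hτ hmem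
      σ.apply_symm_apply }

variable [IsScalarTower k K F]

lemma p_eq [IsAlgClosure k K] (μ : M) (u : D.Cover F) (α : (C μ).f.rootSet F)
    (α₀ : (C μ).f.rootSet K) (h : algebraMap K F α₀ = α) :
    D.p F μ u α = (C μ).coords (u.1 ⟨μ, α₀⟩) := by
  have e : (exists_root_lift (K := K) α).choose = α₀ :=
    Subtype.ext ((algebraMap K F).injective ((exists_root_lift α).choose_spec.trans h.symm))
  rw [p, e]

/-- A root in `K`, seen in `F`. -/
def rootMap {f : Polynomial k} (α : f.rootSet K) : f.rootSet F :=
  ⟨algebraMap K F α, by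
    have h := Polynomial.mem_rootSet.mp α.2
    refine Polynomial.mem_rootSet.mpr ⟨h.1, ?_⟩
    rw [Polynomial.aeval_algebraMap_apply, h.2, map_zero]⟩

/-- Commuting with `p_μ` prescribes the coordinates of every component of the image of `u`, and
coordinates determine points. -/
lemma apply_eq_conj [IsAlgClosure k K] (g : D.structureAut F) (τ : K ≃ₐ[k] K)
    (hτ : ∀ x, algebraMap K F (τ x) = g.1.2 (algebraMap K F x)) (u : D.Cover F) {μ : M}
    {α α' : (C μ).f.rootSet K} (h : (α' : K) = τ α) :
    (g.1.1 u).1 ⟨μ, α'⟩ = CoverPresentation.Points.conj (c := C μ) g.1.2 τ hτ h (u.1 ⟨μ, α⟩) := by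
  apply CoverPresentation.coords_injective
  rw [CoverPresentation.Points.coords_conj]
  have e := g.2 μ u (rootMap α) (rootMap α') (by
    change algebraMap K F α' = g.1.2 (algebraMap K F α)
    rw [h, hτ])
  rwa [D.p_eq μ _ (rootMap α') α' rfl, D.p_eq μ _ (rootMap α) α rfl] at e

/-- The image of `u` is again a compatible family, and its components are the conjugates of those of
`u`. So the distinguished morphism between conjugate varieties has the required value at one point,
which suffices. -/
lemma mem_gSharp_of_structureAut [IsAlgClosure k K]
    (hconn : ∀ i : Index C K, ConnectedSpace ↥(Var i)) (u : D.Cover F)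
    (g : D.structureAut F) (τ : K ≃ₐ[k] K)
    (hτ : ∀ x, algebraMap K F (τ x) = g.1.2 (algebraMap K F x)) : τ ∈ D.gSharp := by
  intro μ ν α α' β β' hα hβ h h'
  have := hconn ⟨μ, α'⟩
  refine IntermediateMorphism.isConj_of_mapPoint g.1.2 τ hτ hα hβ (u.1 ⟨μ, α⟩) ?_
  rw [u.mapPoint_dist h, ← D.apply_eq_conj g τ hτ u hα, ← D.apply_eq_conj g τ hτ u hβ]
  exact (g.1.1 u).mapPoint_dist h'

lemma p_conjCover [IsAlgClosure k K] (σ : F ≃ₐ[k] F) (τ : K ≃ₐ[k] K)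
    (hτ : ∀ x, algebraMap K F (τ x) = σ (algebraMap K F x)) (hmem : τ ∈ D.gSharp)
    (μ : M) (u : D.Cover F) (α α' : (C μ).f.rootSet F) (h : (α' : F) = σ α) :
    D.p F μ (D.conjCover σ τ hτ hmem u) α' = projAct N σ (D.p F μ u α) := by
  obtain ⟨α₀, hα₀⟩ := exists_root_lift (K := K) α
  obtain ⟨α₁, hα₁⟩ := exists_conj_root τ α₀
  rw [D.p_eq μ _ α' α₁ (by rw [h, hα₁, hτ, hα₀]), D.p_eq μ _ α α₀ hα₀,
    D.conjCover_apply σ τ hτ hmem u hα₁, CoverPresentation.Points.coords_conj]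

/-- The automorphism of the structure induced by an automorphism of `F` whose restriction to `K` is
in `G^♯`. -/
noncomputable def conjAut [IsAlgClosure k K] (σ : F ≃ₐ[k] F) (τ : K ≃ₐ[k] K)
    (hτ : ∀ x, algebraMap K F (τ x) = σ (algebraMap K F x)) (hmem : τ ∈ D.gSharp) :
    D.structureAut F :=
  ⟨(D.conjPerm σ τ hτ hmem, σ), D.p_conjCover σ τ hτ hmem⟩

lemma structureAut_ext [IsAlgClosure k K] [Normal k K] (g g' : D.structureAut F)
    (h : g.1.2 = g'.1.2) : g = g' := by
  have hτ (x : K) : algebraMap K F (AlgEquiv.restrictNormal g.1.2 K x) =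
      g.1.2 (algebraMap K F x) := AlgEquiv.restrictNormal_commutes _ _ _
  refine Subtype.ext (Prod.ext (Equiv.ext fun u => Subtype.ext (funext fun ⟨μ, α'⟩ => ?_)) h)
  obtain ⟨α, hα⟩ := exists_root_apply (AlgEquiv.restrictNormal g.1.2 K) α'
  rw [D.apply_eq_conj g _ hτ u hα, D.apply_eq_conj g' _ (fun x => by rw [hτ, h]) u hα]
  apply CoverPresentation.Points.ext_total
  rw [CoverPresentation.Points.conj_total, CoverPresentation.Points.conj_total, h]

/-- Restriction of automorphisms of the structure to the field sort is an isomorphism onto the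
group of automorphisms over `k^♯`. -/
lemma exists_mulEquiv [IsAlgClosure k K] [IsGalois k K]
    (hconn : ∀ i : Index C K, ConnectedSpace ↥(Var i)) (u₀ : D.Cover K) (u : D.Cover F) :
    ∃ e : D.structureAut F ≃* (F ≃ₐ[D.kSharp] F),
      ∀ (g : D.structureAut F) (x : F), e g x = g.1.2 x := by
  have hτ (σ : F ≃ₐ[k] F) (x : K) : algebraMap K F (AlgEquiv.restrictNormal σ K x) =
      σ (algebraMap K F x) := AlgEquiv.restrictNormal_commutes _ _ _
  have hfix (g : D.structureAut F) (x : D.kSharp) :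
      g.1.2 (algebraMap D.kSharp F x) = algebraMap D.kSharp F x := by
    have h := D.mem_gSharp_of_structureAut hconn u g _ (hτ g.1.2)
    rw [IsScalarTower.algebraMap_apply D.kSharp K F, ← hτ g.1.2]
    exact congrArg (algebraMap K F) (x.2 ⟨_, h⟩)
  let φ : D.structureAut F →* (F ≃ₐ[D.kSharp] F) :=
    { toFun g := AlgEquiv.ofRingEquiv (f := (g.1.2 : F ≃+* F)) (hfix g)
      map_one' := rfl
      map_mul' _ _ := rfl }
  refine ⟨MulEquiv.ofBijective φ ⟨fun g g' h => ?_, fun σ => ?_⟩, fun _ _ => rfl⟩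
  · exact D.structureAut_ext g g' (AlgEquiv.ext fun x => DFunLike.congr_fun h x)
  · let σ' : F ≃ₐ[k] F := AlgEquiv.ofRingEquiv (f := (σ : F ≃+* F)) fun x => by
      have h := σ.commutes (algebraMap k D.kSharp x)
      rw [IsScalarTower.algebraMap_apply D.kSharp K F, ← IsScalarTower.algebraMap_apply k D.kSharp K,
        ← IsScalarTower.algebraMap_apply k K F] at h
      exact h
    -- Surjectivity rests on the closedness of `G^♯`: the restriction of `σ` to `K` fixes `k^♯`.
    have hmem : AlgEquiv.restrictNormal σ' K ∈ D.gSharp :=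
      D.mem_gSharp_of_fixes_kSharp hconn u₀ _ fun x hx => (algebraMap K F).injective (by
        rw [hτ σ']
        have h := σ.commutes ⟨x, hx⟩
        rw [IsScalarTower.algebraMap_apply D.kSharp K F] at h
        exact h)
    exact ⟨D.conjAut σ' _ (hτ σ') hmem, AlgEquiv.ext fun _ => rfl⟩

end DistinguishedSystem

end EtaleCoverStructure

open CategoryTheory AlgebraicGeometry EtaleCoverStructure in
theorem proposition5p4
    {k : Type u} [Field k] [CharZero k]
    -- the algebraic closure `K` of `k`
    {K : Type u} [Field K] [Algebra k K] [IsAlgClosure k K]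
    -- a smooth geometrically connected quasi-projective variety over `k`
    {X : Scheme.{u}} (s : X ⟶ Spec (.of k)) [Smooth s] [GeometricallyConnected s]
    (hX : IsQuasiProjective s)
    -- the family of all its finite étale Galois covers
    {N : ℕ} {M : Type v} (C : M → CoverPresentation s N) (hC : RepresentsAllCovers C)
    -- a projective system of distinguished morphisms
    (D : DistinguishedSystem C K)
    -- an algebraically closed field containing `K`
    (F : Type u) [Field F] [IsAlgClosed F] [Algebra k F] [Algebra K F] [IsScalarTower k K F] :
    (∃ e : D.structureAut F ≃* (F ≃ₐ[D.kSharp] F),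
      ∀ (g : D.structureAut F) (x : F), e g x = g.1.2 x) ∧
    (∃ e : D.structureAut K ≃* (K ≃ₐ[D.kSharp] K),
      ∀ (g : D.structureAut K) (x : K), e g x = g.1.2 x) := by
  have : IsAlgClosed K := IsAlgClosure.isAlgClosed k
  have : Algebra.IsAlgebraic k K := IsAlgClosure.isAlgebraic
  have : IsGalois k K := IsAlgClosure.isGalois k K
  have : ConnectedSpace X := GeometricallyConnected.connectedSpace_of_subsingleton (f := s)
  have : TopologicalSpace.NoetherianSpace X := hX.noetherianSpace
  have (μ : M) : CompactSpace (C μ).Y := QuasiCompact.compactSpace_of_compactSpace (C μ).π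
  have (μ : M) : QuasiSeparatedSpace (C μ).Y := by
    have := LocallyOfFiniteType.isLocallyNoetherian ((C μ).π ≫ s)
    infer_instance
  have hconn (i : Index C K) : ConnectedSpace ↥(Var i) := (C i.1).connectedSpace_variety i.2
  obtain ⟨x, hx⟩ := exists_geometric_point (F := F) s
  obtain ⟨x₀, hx₀⟩ := exists_geometric_point (F := K) s
  obtain ⟨u⟩ := D.nonempty_cover hC x hx
  -- Closedness of `G^♯` is tested at a point over `K` itself, as the approximating elements of
  -- `G^♯` act only on `K`.
  obtain ⟨u₀⟩ := D.nonempty_cover hC x₀ hx₀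
  exact ⟨D.exists_mulEquiv hconn u₀ u, D.exists_mulEquiv hconn u₀ u₀⟩
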